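/- Let $p>1$, $p'=\min(2,p)$, $p''=\max(2,p)$ and $q=p''/p'$. There is a constant $C$ depending only on $p$ such that the following holds. Let $(\Omega,\mathcal A,\mathbb P)$ be a probability space, $\theta:\Omega\to\Omega$ a bijective bi-measurable transformation preserving $\mathbb P$, and $\mathcal F_0\subseteq\mathcal A$ a $\sigma$-algebra with $\mathcal F_0\subseteq\theta^{-1}(\mathcal F_0)$; put $\mathcal F_i=\theta^{-i}(\mathcal F_0)$, $\mathbb E_i(\cdot)=\mathbb E(\cdot\mid\mathcal F_i)$ and $\mathcal P_i=\mathbb E_i-\mathbb E_{i-1}$ for $i\in\mathbb Z$. Let $\mathcal H$ be a real separable Hilbert space, let $X_0:\Omega\to\mathcal H$ be $\mathcal F_0$-measurable and centered with $\|X_0\|_{p,\mathcal H}=(\mathbb E|X_0|_{\mathcal H}^p)^{1/p}<\infty$, and put $X_i=X_0\circ\theta^i$, $S_n=X_1+\cdots+X_n$. Assume that $$\sum_{n\ge1}\frac{\|\mathbb E_0(S_n)\|_{p,\mathcal H}}{n^{1+1/p''}}<\infty .$$ Then, for every $n\ge0$, the series $T_n=\sum_{k\ge n}\frac{\mathcal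 P_0(X_k)}{k+1}$ converges in $\mathbb L^p(\mathcal H)$; the series $\sum_{n\ge0}|T_n|_{\mathcal H}$ converges in $\mathbb L^p$; the series $D=\sum_{n\ge0}T_n=\sum_{n\ge0}\sum_{k\ge n}\frac{\mathcal P_0(X_k)}{k+1}$ converges in $\mathbb L^p(\mathcal H)$; and, with $M_n=\sum_{k=1}^nD\circ\theta^k$, for all integers $n\ge1$, $$\|S_n-M_n\|_{p,\mathcal H}\le C\,n^{1/p'}\sum_{k\ge[n^q]}\frac{\|\mathbb E_0(S_k)\|_{p,\mathcal H}}{k^{1+1/p''}},$$ where $[x]$ denotes the integer part of $x$. -/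

import Mathlib

open MeasureTheory Filter Topology
open scoped ENNReal NNReal

universe u v

noncomputable section

namespace MartApprox

variable {Ω H : Type*}

/-- The integer iterate `θ^i` of a bijective bi-measurable transformation. -/
def iter {mΩ : MeasurableSpace Ω} (θ : Ω ≃ᵐ Ω) (i : ℤ) : Ω → Ω :=
  ⇑((θ.toEquiv : Equiv.Perm Ω) ^ i)

/-- The σ-algebra `F_i = θ^{-i}(F₀)`. -/
abbrev sigmaAlg (F₀ : MeasurableSpace Ω) {mΩ : MeasurableSpace Ω} (θ : Ω ≃ᵐ Ω) (i : ℤ) :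
    MeasurableSpace Ω :=
  F₀.comap (iter θ i)

/-- The stationary sequence `Y_i = Y ∘ θ^i` generated by `Y`. -/
def shift {mΩ : MeasurableSpace Ω} (θ : Ω ≃ᵐ Ω) (Y : Ω → H) (i : ℤ) : Ω → H :=
  fun ω => Y (iter θ i ω)

/-- The partial sum `Y ∘ θ + ⋯ + Y ∘ θ^n`: this is `S_n` for `Y = X₀`, and `M_n` for `Y = D`. -/
def partialSum [AddCommMonoid H] {mΩ : MeasurableSpace Ω} (θ : Ω ≃ᵐ Ω) (Y : Ω → H) (n : ℕ) :
    Ω → H :=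
  fun ω => ∑ k ∈ Finset.Icc 1 n, shift θ Y (k : ℤ) ω

variable [NormedAddCommGroup H] [NormedSpace ℝ H]

/-- The conditional expectation `E_k(Y) = E(Y | F_k)`. -/
def condE [CompleteSpace H] (F₀ : MeasurableSpace Ω) {mΩ : MeasurableSpace Ω} (P : Measure Ω)
    (θ : Ω ≃ᵐ Ω) (k : ℤ) (Y : Ω → H) : Ω → H :=
  condExp (sigmaAlg F₀ θ k) P Y

/-- The projection `P_k(Y) = E_k(Y) - E_{k-1}(Y)`. -/
def proj [CompleteSpace H] (F₀ : MeasurableSpace Ω) {mΩ : MeasurableSpace Ω} (P : Measure Ω)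
    (θ : Ω ≃ᵐ Ω) (k : ℤ) (Y : Ω → H) : Ω → H :=
  fun ω => condE F₀ P θ k Y ω - condE F₀ P θ (k - 1) Y ω

/-- The series `∑_{n ≥ 0} f n` converges in `L^p` and its sum is (the class of) `g`. -/
def LpHasSum {E : Type*} [NormedAddCommGroup E] {mΩ : MeasurableSpace Ω} (P : Measure Ω)
    (p : ℝ) (f : ℕ → Ω → E) (g : Ω → E) : Prop :=
  MemLp g (ENNReal.ofReal p) P ∧
    Tendsto (fun N : ℕ =>
      eLpNorm (fun ω => (∑ n ∈ Finset.range N, f n ω) - g ω) (ENNReal.ofReal p) P) atTop (𝓝 0)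

/-- `∑_{k ≥ m} ‖E_0(S_k)‖_p / k^{1 + 1/p''}` with `p'' = max 2 p`, as an extended nonnegative
number. -/
def mwTail [CompleteSpace H] (F₀ : MeasurableSpace Ω) {mΩ : MeasurableSpace Ω} (P : Measure Ω)
    (θ : Ω ≃ᵐ Ω) (X₀ : Ω → H) (p : ℝ) (m : ℕ) : ℝ≥0∞ :=
  ∑' j : ℕ, eLpNorm (condE F₀ P θ 0 (partialSum θ X₀ (m + j))) (ENNReal.ofReal p) P /
    ((m + j : ℕ) : ℝ≥0∞) ^ (1 + 1 / max 2 p)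

end MartApprox

end

/-! ### Abstract shifts on a Banach space; martingale type and cotype -/

namespace MartApprox

/-! The probabilistic content is carried by two operators on $V = L^p(H)$: the isometry $U f = f
\circ \theta$ and the contraction $Q = \mathbb E_0$. The inclusion $\mathcal F_0 \subseteq \mathcal
F_1$ becomes $QUQ = QU$ and $QU^{-1}Q = U^{-1}Q$; then $R = U^{-1}QU$ is $\mathbb E_{-1}$ and
`innov` $= Q - R$ is $\mathcal P_0$. Geometry enters through two-point inequalities only. Smoothness
of power type $s' = \min(2,p)$ bounds the $s'$-th power of the norm of a martingale by the sum of
those of its increments (`norm_sum_zpow_rpow_le`); convexity of power type $s = \max(2,p)$ gives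
$\sum_j \|\mathcal P_0 U^j y\|^s \lesssim \|\mathbb E_0 y\|^s$ (`tsum_enorm_innov_zpow_rpow_le`).

Write $a_l = \|\mathbb E_0 S_l\|_p$ and $W_N = \sum_{k\ge N} a_k/k^{1+1/s}$. Since $a_l \le a_{l+k}
+ a_k$, averaging over a block of $N$ values of $k$ gives $a_l \lesssim N^{1/s} W_N$ for $l \le 3N$
(`le_wTail`).

Construction of $D$: summation by parts writes $T_n$ through $\mathcal P_0(U^{n-1} S_l)$ with
weights of order $(n+l)^{-2}$. Hölder's inequality in $n$, with the cotype inequality for one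
factor, gives $\sum_{n\ge N}\|T_n\| \lesssim W_N$. Moreover $T_m - T_{m+1} = \mathcal
P_0(X_m)/(m+1)$ telescopes to $D = \sum_{j<M}\mathcal P_0(X_j) + M T_M + \sum_{m\ge M} T_m$
(`generator_eq`), so $D$ is a regularized $\sum_j \mathcal P_0(X_j)$.

Approximation: take $N = [n^q]$, let $z$ be the average of $S_N,\dots,S_{2N-1}$ and $y = S_n + U^n
z$, an average of $S_{n+N+i}$. Decomposing $\mathbb E_n y - \mathbb E_0 y$ into innovations gives
$S_n - M_n = \mathbb E_0 y - U^n \mathbb E_0 z + \sum_{k<n} U^{k+1}(d_k - D)$, with $d_k = \mathcal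
P_0(U^{-(k+1)}y)$ an average of partial sums of $\sum_j \mathcal P_0(X_j)$. The first two terms are
$\lesssim N^{1/s}W_N \le n^{1/s'}W_N$; each $d_k - D$ is an innovation of norm $\lesssim W_N$, so
martingale type bounds the sum by $n^{1/s'}W_N$. -/

/-- An isometric shift `U` of a Banach space together with a contractive projection `Q`, abstracting
composition with a measure preserving transformation and conditioning on the present. -/
structure AdaptedShift (V : Type*) [NormedAddCommGroup V] [NormedSpace ℝ V] where
  /-- The shift. -/
  U : V ≃ₗᵢ[ℝ] V
  /-- The projection on the present. -/
  Q : V →L[ℝ] V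
  norm_Q_le : ∀ v, ‖Q v‖ ≤ ‖v‖
  Q_Q : ∀ v, Q (Q v) = Q v
  Q_U_Q : ∀ v, Q (U (Q v)) = Q (U v)
  Q_symm_Q : ∀ v, Q (U.symm (Q v)) = U.symm (Q v)

namespace AdaptedShift

variable {V : Type*} [NormedAddCommGroup V] [NormedSpace ℝ V] (A : AdaptedShift V)

/-- The projection on the past. -/
noncomputable def R : V →L[ℝ] V :=
  (A.U.symm : V →L[ℝ] V) ∘L A.Q ∘L (A.U : V →L[ℝ] V)

/-- The innovation operator. -/
noncomputable def innov : V →L[ℝ] V := A.Q - A.R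

lemma R_apply (v : V) : A.R v = A.U.symm (A.Q (A.U v)) := rfl

lemma innov_apply (v : V) : A.innov v = A.Q v - A.R v := rfl

lemma norm_R_le (v : V) : ‖A.R v‖ ≤ ‖v‖ := by
  rw [R_apply, LinearIsometryEquiv.norm_map]
  exact (A.norm_Q_le _).trans_eq (LinearIsometryEquiv.norm_map _ _)

lemma R_Q (v : V) : A.R (A.Q v) = A.R v := by
  rw [R_apply, A.Q_U_Q, R_apply]

lemma Q_R (v : V) : A.Q (A.R v) = A.R v := by
  rw [R_apply, A.Q_symm_Q]

lemma R_R (v : V) : A.R (A.R v) = A.R v := by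
  simp [R_apply, A.Q_Q]

lemma R_symm_of_Q {v : V} (hv : A.Q v = v) : A.R (A.U.symm v) = A.U.symm v := by
  simp [R_apply, hv]

lemma Q_innov (v : V) : A.Q (A.innov v) = A.innov v := by
  rw [innov_apply, map_sub, A.Q_Q, Q_R]

lemma R_innov (v : V) : A.R (A.innov v) = 0 := by
  rw [innov_apply, map_sub, R_Q, R_R, sub_self]

lemma zpow_add_apply (a b : ℤ) (v : V) : (A.U ^ (a + b)) v = (A.U ^ a) ((A.U ^ b) v) := by
  rw [zpow_add]; rfl

lemma zpow_succ_apply (k : ℤ) (v : V) : (A.U ^ (k + 1)) v = A.U ((A.U ^ k) v) := by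
  rw [add_comm, zpow_add_apply, zpow_one]

lemma zpow_pred_apply (k : ℤ) (v : V) : (A.U ^ (k - 1)) v = A.U.symm ((A.U ^ k) v) := by
  rw [sub_eq_neg_add, zpow_add_apply, zpow_neg_one]; rfl

lemma zpow_neg_apply_zpow (k : ℤ) (v : V) : (A.U ^ (-k)) ((A.U ^ k) v) = v := by
  rw [← zpow_add_apply]; simp

lemma zpow_apply_zpow_neg (k : ℤ) (v : V) : (A.U ^ k) ((A.U ^ (-k)) v) = v := by
  rw [← zpow_add_apply]; simp

lemma Q_zpow_Q (l : ℕ) (v : V) : A.Q ((A.U ^ (l : ℤ)) (A.Q v)) = A.Q ((A.U ^ (l : ℤ)) v) := by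
  induction l with
  | zero => simp [A.Q_Q]
  | succ l ih =>
    push_cast
    rw [zpow_succ_apply, zpow_succ_apply, ← A.Q_U_Q, ih, A.Q_U_Q]

lemma Q_zpow_neg {v : V} (hv : A.Q v = v) (l : ℕ) :
    A.Q ((A.U ^ (-(l : ℤ))) v) = (A.U ^ (-(l : ℤ))) v := by
  induction l with
  | zero => simp [hv]
  | succ l ih =>
    have h : (-((l + 1 : ℕ) : ℤ)) = -(l : ℤ) - 1 := by push_cast; ring
    rw [h, zpow_pred_apply, ← ih, A.Q_symm_Q]

lemma innov_zpow_neg_succ {v : V} (hv : A.Q v = v) (l : ℕ) :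
    A.innov ((A.U ^ (-(l : ℤ) - 1)) v) = 0 := by
  have h : (-(l : ℤ) - 1) = -((l + 1 : ℕ) : ℤ) := by push_cast; ring
  rw [innov_apply, sub_eq_zero]
  rw [h, A.Q_zpow_neg hv, ← h, zpow_pred_apply, A.R_symm_of_Q (A.Q_zpow_neg hv l)]

/-- The partial sum `U x + ⋯ + U ^ n x`. -/
noncomputable def S (x : V) (n : ℕ) : V := ∑ k ∈ Finset.range n, (A.U ^ ((k : ℤ) + 1)) x

lemma S_add (x : V) (m n : ℕ) : A.S x (m + n) = A.S x m + (A.U ^ (m : ℤ)) (A.S x n) := by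
  simp only [S, Finset.sum_range_add, map_sum, ← zpow_add_apply]
  push_cast
  simp only [add_assoc]

/-- Since $S_{l+k} = S_l + U^l S_k$ and $QU^l = QU^lQ$, the difference $QS_{l+k} - QS_l = QU^lQS_k$
has norm at most $\|QS_k\|$. This is the only property of the sequence used in the weighted-tail
estimates. -/
lemma norm_Q_S_le (x : V) (l k : ℕ) :
    ‖A.Q (A.S x l)‖ₑ ≤ ‖A.Q (A.S x (l + k))‖ₑ + ‖A.Q (A.S x k)‖ₑ := by
  have h : A.Q (A.S x l) = A.Q (A.S x (l + k)) - A.Q ((A.U ^ (l : ℤ)) (A.Q (A.S x k))) := by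
    rw [A.Q_zpow_Q, S_add, map_add]; abel
  rw [h]
  refine (enorm_sub_le).trans (add_le_add_right ?_ _)
  rw [← ofReal_norm, ← ofReal_norm]
  exact ENNReal.ofReal_le_ofReal ((A.norm_Q_le _).trans_eq (LinearIsometryEquiv.norm_map _ _))

/-- Uniform smoothness of power type `s`. -/
def _root_.MartApprox.SmoothType (V : Type*) [NormedAddCommGroup V] (s C : ℝ) : Prop :=
  ∀ x y : V, ‖x + y‖ ^ s + ‖x - y‖ ^ s ≤ 2 * ‖x‖ ^ s + C * ‖y‖ ^ s

/-- Uniform convexity of power type `s`. -/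
def _root_.MartApprox.ConvexType (V : Type*) [NormedAddCommGroup V] (s c : ℝ) : Prop :=
  ∀ x y : V, 2 * ‖x‖ ^ s + c * ‖y‖ ^ s ≤ ‖x + y‖ ^ s + ‖x - y‖ ^ s

variable {A}

/-- As $R(x-d) = x$ and $R$ is a contraction, $\|x\| \le \|x-d\|$; the second term of the two-point
inequality therefore absorbs one copy of $\|x\|^s$. -/
lemma norm_add_rpow_le {s C : ℝ} (hs : 0 ≤ s) (hV : SmoothType V s C) {x d : V}
    (hx : A.R x = x) (hd : A.R d = 0) : ‖x + d‖ ^ s ≤ ‖x‖ ^ s + C * ‖d‖ ^ s := by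
  have h1 : ‖x‖ ^ s ≤ ‖x - d‖ ^ s := by
    refine Real.rpow_le_rpow (norm_nonneg _) ?_ hs
    simpa [hx, hd] using A.norm_R_le (x - d)
  linarith [hV x d]

/-- Martingale type inequality. -/
lemma norm_sum_zpow_rpow_le {s C : ℝ} (hs : 0 < s) (hV : SmoothType V s C) {d : ℕ → V}
    (hQ : ∀ k, A.Q (d k) = d k) (hR : ∀ k, A.R (d k) = 0) (n : ℕ) :
    ‖∑ k ∈ Finset.range n, (A.U ^ ((k : ℤ) + 1)) (d k)‖ ^ s ≤
      C * ∑ k ∈ Finset.range n, ‖d k‖ ^ s := by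
  -- Pulling the sum back to time 0 makes each step the addition of an innovation to the past vector
  -- $U^{-1}w_n$.
  set w : ℕ → V := fun n => (A.U ^ (-(n : ℤ))) (∑ k ∈ Finset.range n, (A.U ^ ((k : ℤ) + 1)) (d k))
    with hw
  have hrec : ∀ n, w (n + 1) = A.U.symm (w n) + d n := by
    intro n
    simp only [hw]
    rw [Finset.sum_range_succ, map_add]
    push_cast
    rw [A.zpow_neg_apply_zpow, neg_add, ← sub_eq_add_neg, zpow_pred_apply]
  have hwQ : ∀ n, A.Q (w n) = w n := by
    intro n
    induction n with
    | zero => simp [hw]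
    | succ n ih =>
      rw [hrec, map_add, hQ]
      congr 1
      rw [← ih, A.Q_symm_Q]
  have key : ‖w n‖ ^ s ≤ C * ∑ k ∈ Finset.range n, ‖d k‖ ^ s := by
    induction n with
    | zero => simp [hw, Real.zero_rpow hs.ne']
    | succ n ih =>
      rw [hrec, Finset.sum_range_succ, mul_add]
      refine (norm_add_rpow_le hs.le hV (A.R_symm_of_Q (hwQ n)) (hR n)).trans ?_
      rw [LinearIsometryEquiv.norm_map]
      linarith
  rwa [hw, LinearIsometryEquiv.norm_map] at key

/-- Two-point convexity is centred at the midpoint of $Rv$ and $v$. The midpoint projects to $Rv$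
under $R$, so its norm is at least $\|Rv\|$; the factor $2^{-s}$ comes from the half-increment. -/
lemma norm_R_rpow_add_le {s c : ℝ} (hs : 0 ≤ s) (hV : ConvexType V s c) (v : V) :
    ‖A.R v‖ ^ s + c * (2⁻¹) ^ s * ‖v - A.R v‖ ^ s ≤ ‖v‖ ^ s := by
  set d := v - A.R v with hd
  have hRd : A.R d = 0 := by rw [hd, map_sub, A.R_R, sub_self]
  have h := hV (A.R v + (2⁻¹ : ℝ) • d) ((2⁻¹ : ℝ) • d)
  have e1 : A.R v + (2⁻¹ : ℝ) • d + (2⁻¹ : ℝ) • d = v := by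
    rw [add_assoc, ← add_smul]; norm_num [hd]
  have e2 : A.R v + (2⁻¹ : ℝ) • d - (2⁻¹ : ℝ) • d = A.R v := by abel
  have h1 : ‖A.R v‖ ^ s ≤ ‖A.R v + (2⁻¹ : ℝ) • d‖ ^ s := by
    refine Real.rpow_le_rpow (norm_nonneg _) ?_ hs
    simpa [hRd, A.R_R] using A.norm_R_le (A.R v + (2⁻¹ : ℝ) • d)
  rw [e1, e2, norm_smul, Real.norm_of_nonneg (by norm_num : (0:ℝ) ≤ 2⁻¹),
    Real.mul_rpow (by norm_num) (norm_nonneg _)] at h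
  linarith

/-- Martingale cotype inequality. -/
lemma sum_norm_innov_zpow_rpow_le {s c : ℝ} (hs : 0 ≤ s) (hV : ConvexType V s c)
    (y : V) (n : ℕ) :
    c * (2⁻¹) ^ s * ∑ j ∈ Finset.range n, ‖A.innov ((A.U ^ (j : ℤ)) y)‖ ^ s ≤ ‖A.Q y‖ ^ s := by
  have key : ‖A.Q ((A.U ^ (n : ℤ)) y)‖ ^ s +
      c * (2⁻¹) ^ s * ∑ j ∈ Finset.range n, ‖A.innov ((A.U ^ (j : ℤ)) y)‖ ^ s ≤ ‖A.Q y‖ ^ s := by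
    induction n with
    | zero => simp
    | succ n ih =>
      have h := norm_R_rpow_add_le hs hV (A := A) (A.Q ((A.U ^ (n : ℤ)) y))
      rw [A.R_Q, ← innov_apply] at h
      -- This identification makes the one-step inequalities telescope: the past part at step $n$
      -- is, up to the isometry, the projection at step $n+1$.
      have h2 : ‖A.R ((A.U ^ (n : ℤ)) y)‖ = ‖A.Q ((A.U ^ ((n + 1 : ℕ) : ℤ)) y)‖ := by
        rw [R_apply, LinearIsometryEquiv.norm_map]
        push_cast
        rw [zpow_succ_apply]
      rw [h2] at h
      rw [Finset.sum_range_succ, mul_add]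
      linarith
  have : 0 ≤ ‖A.Q ((A.U ^ (n : ℤ)) y)‖ ^ s := by positivity
  linarith

/-- Martingale cotype inequality for the infinite series, with extended norms. -/
lemma tsum_enorm_innov_zpow_rpow_le {s c : ℝ} (hs : 0 < s) (hc : 0 < c) (hV : ConvexType V s c)
    (y : V) :
    (∑' j : ℕ, ‖A.innov ((A.U ^ (j : ℤ)) y)‖ₑ ^ s) ^ (1 / s) ≤
      ENNReal.ofReal (2 * c⁻¹ ^ (1 / s)) * ‖A.Q y‖ₑ := by
  have hK : 0 < c * (2⁻¹ : ℝ) ^ s := by positivity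
  have h1 : ∑' j : ℕ, ‖A.innov ((A.U ^ (j : ℤ)) y)‖ₑ ^ s ≤
      ENNReal.ofReal ((2 * c⁻¹ ^ (1 / s) * ‖A.Q y‖) ^ s) := by
    refine ENNReal.tsum_le_of_sum_range_le fun n => ?_
    simp_rw [← ofReal_norm, ENNReal.ofReal_rpow_of_nonneg (norm_nonneg _) hs.le]
    rw [← ENNReal.ofReal_sum_of_nonneg (fun i _ => by positivity)]
    refine ENNReal.ofReal_le_ofReal ?_
    have h := sum_norm_innov_zpow_rpow_le (A := A) hs.le hV y n
    rw [Real.mul_rpow (by positivity) (norm_nonneg _),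
      Real.mul_rpow (by positivity) (by positivity),
      ← Real.rpow_mul (by positivity), one_div_mul_cancel hs.ne', Real.rpow_one]
    rw [Real.inv_rpow (by norm_num)] at h
    have h2 : (0:ℝ) < 2 ^ s := by positivity
    have h3 : ∑ j ∈ Finset.range n, ‖A.innov ((A.U ^ (j : ℤ)) y)‖ ^ s =
        2 ^ s * c⁻¹ * (c * (2 ^ s)⁻¹ *
          ∑ j ∈ Finset.range n, ‖A.innov ((A.U ^ (j : ℤ)) y)‖ ^ s) := by
      field_simp
    rw [h3]
    gcongr
  calc _ ≤ (ENNReal.ofReal ((2 * c⁻¹ ^ (1 / s) * ‖A.Q y‖) ^ s)) ^ (1 / s) := by gcongr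
    _ = _ := by
      rw [ENNReal.ofReal_rpow_of_nonneg (by positivity) (by positivity),
        ← Real.rpow_mul (by positivity), mul_one_div_cancel hs.ne', Real.rpow_one,
        ENNReal.ofReal_mul (by positivity), ofReal_norm]

end AdaptedShift

end MartApprox

/-! ### Weighted tails of subadditive-type sequences -/

namespace MartApprox

/-- The weighted tail `∑_{k ≥ m} a k / k ^ (1 + 1 / s)`. -/
noncomputable def wTail (a : ℕ → ℝ≥0∞) (s : ℝ) (m : ℕ) : ℝ≥0∞ :=
  ∑' j : ℕ, a (m + j) / ((m + j : ℕ) : ℝ≥0∞) ^ (1 + 1 / s)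

lemma wTail_anti (a : ℕ → ℝ≥0∞) (s : ℝ) {m n : ℕ} (h : m ≤ n) : wTail a s n ≤ wTail a s m := by
  obtain ⟨k, rfl⟩ := Nat.exists_eq_add_of_le h
  simp only [wTail, add_assoc]
  exact ENNReal.tsum_comp_le_tsum_of_injective (f := fun j => k + j) (add_right_injective k)
    (fun j => a (m + j) / ((m + j : ℕ) : ℝ≥0∞) ^ (1 + 1 / s))

/-- All indices lie between $N$ and $5N$, so the weights in the tail are comparable with
$N^{1+1/s}$, up to $5^{1+1/s} \le 25$. -/
lemma sum_block_le_wTail (a : ℕ → ℝ≥0∞) {s : ℝ} (hs : 1 ≤ s) {N l : ℕ}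
    (hl : l ≤ 3 * N) :
    ∑ i ∈ Finset.range N, a (N + (l + i)) ≤ 25 * (N : ℝ≥0∞) ^ (1 + 1 / s) * wTail a s N := by
  have hs0 : 0 < s := by linarith
  have h1s : 1 / s ≤ 1 := by rw [div_le_one hs0]; exact hs
  have hα : (0:ℝ) ≤ 1 + 1 / s := by positivity
  have h5 : (5 : ℝ≥0∞) ^ (1 + 1 / s) ≤ 25 := by
    calc (5 : ℝ≥0∞) ^ (1 + 1 / s) ≤ 5 ^ (2 : ℝ) :=
          ENNReal.rpow_le_rpow_of_exponent_le (by norm_num) (by linarith)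
      _ = 25 := by norm_num
  calc ∑ i ∈ Finset.range N, a (N + (l + i))
      ≤ ∑ i ∈ Finset.range N, 25 * (N : ℝ≥0∞) ^ (1 + 1 / s) *
          (a (N + (l + i)) / ((N + (l + i) : ℕ) : ℝ≥0∞) ^ (1 + 1 / s)) := by
        refine Finset.sum_le_sum fun i hi => ?_
        have hi := Finset.mem_range.1 hi
        have h0 : ((N + (l + i) : ℕ) : ℝ≥0∞) ^ (1 + 1 / s) ≠ 0 := by
          simp only [ne_eq, ENNReal.rpow_eq_zero_iff, not_or]
          refine ⟨fun h => ?_, fun h => (ENNReal.natCast_ne_top _ h.1).elim⟩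
          have := h.1
          rw [Nat.cast_eq_zero] at this; omega
        have ht : ((N + (l + i) : ℕ) : ℝ≥0∞) ^ (1 + 1 / s) ≠ ∞ :=
          ENNReal.rpow_ne_top_of_nonneg hα (ENNReal.natCast_ne_top _)
        calc a (N + (l + i)) = ((N + (l + i) : ℕ) : ℝ≥0∞) ^ (1 + 1 / s) *
              (a (N + (l + i)) / ((N + (l + i) : ℕ) : ℝ≥0∞) ^ (1 + 1 / s)) :=
              (ENNReal.mul_div_cancel h0 ht).symm
          _ ≤ _ := by
            gcongr
            calc ((N + (l + i) : ℕ) : ℝ≥0∞) ^ (1 + 1 / s) ≤ (5 * (N : ℝ≥0∞)) ^ (1 + 1 / s) := by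
                  gcongr
                  exact_mod_cast (by omega : N + (l + i) ≤ 5 * N)
              _ = 5 ^ (1 + 1 / s) * (N : ℝ≥0∞) ^ (1 + 1 / s) :=
                  ENNReal.mul_rpow_of_nonneg _ _ hα
              _ ≤ _ := by gcongr
    _ = 25 * (N : ℝ≥0∞) ^ (1 + 1 / s) * ∑ i ∈ Finset.range N,
          (a (N + (l + i)) / ((N + (l + i) : ℕ) : ℝ≥0∞) ^ (1 + 1 / s)) := by rw [Finset.mul_sum]
    _ ≤ _ := by
      gcongr
      refine (ENNReal.sum_le_tsum _).trans ?_
      exact ENNReal.tsum_comp_le_tsum_of_injective (f := fun j => l + j) (add_right_injective l)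
        (fun j => a (N + j) / ((N + j : ℕ) : ℝ≥0∞) ^ (1 + 1 / s))

lemma natCast_rpow_one_add {N : ℕ} (hN : 1 ≤ N) (t : ℝ) :
    (N : ℝ≥0∞) ^ (1 + t) = N * (N : ℝ≥0∞) ^ t := by
  rw [ENNReal.rpow_add _ _ (by simpa using (by omega : N ≠ 0)) (ENNReal.natCast_ne_top _),
    ENNReal.rpow_one]

/-- A term with index at most `3 N` of a sequence with `a l ≤ a (l + k) + a k` is controlled by the
weighted tail from `N` on. -/
lemma le_wTail (a : ℕ → ℝ≥0∞) (ha : ∀ l k, a l ≤ a (l + k) + a k) {s : ℝ} (hs : 1 ≤ s)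
    {N l : ℕ} (hN : 1 ≤ N) (hl : l ≤ 3 * N) :
    a l ≤ 50 * (N : ℝ≥0∞) ^ (1 / s) * wTail a s N := by
  have hN0 : (N : ℝ≥0∞) ≠ 0 := by simpa using (by omega : N ≠ 0)
  have h1 : (N : ℝ≥0∞) * a l ≤ N * (50 * (N : ℝ≥0∞) ^ (1 / s) * wTail a s N) := by
    calc (N : ℝ≥0∞) * a l = ∑ i ∈ Finset.range N, a l := by simp
      -- The hypothesis is applied with $k = N+i$ and averaged over $i < N$; both resulting blocks
      -- lie in the tail.
      _ ≤ ∑ i ∈ Finset.range N, (a (N + (l + i)) + a (N + (0 + i))) := by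
          refine Finset.sum_le_sum fun i _ => ?_
          have h := ha l (N + i)
          rwa [zero_add, show N + (l + i) = l + (N + i) by omega]
      _ ≤ 25 * (N : ℝ≥0∞) ^ (1 + 1 / s) * wTail a s N +
            25 * (N : ℝ≥0∞) ^ (1 + 1 / s) * wTail a s N := by
          rw [Finset.sum_add_distrib]
          exact add_le_add (sum_block_le_wTail a hs hl) (sum_block_le_wTail a hs (by omega))
      _ = _ := by rw [natCast_rpow_one_add hN]; ring
  exact (ENNReal.mul_le_mul_iff_right hN0 (ENNReal.natCast_ne_top _)).1 h1

lemma tsum_mul_le_Lp_mul_Lq (f g : ℕ → ℝ≥0∞) {p q : ℝ} (hpq : p.HolderConjugate q) :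
    ∑' i, f i * g i ≤ (∑' i, f i ^ p) ^ (1 / p) * (∑' i, g i ^ q) ^ (1 / q) := by
  refine ENNReal.tsum_le_of_sum_range_le fun n => ?_
  refine (ENNReal.inner_le_Lp_mul_Lq (Finset.range n) f g hpq).trans ?_
  have := hpq.pos
  have := hpq.symm.pos
  gcongr <;> exact ENNReal.sum_le_tsum _

lemma sum_range_inv_sq_le {m : ℕ} (hm : 1 ≤ m) (n : ℕ) :
    ∑ i ∈ Finset.range n, (((m + i : ℕ) : ℝ) ^ 2)⁻¹ ≤ 2 * ((m : ℝ)⁻¹ - ((m + n : ℕ) : ℝ)⁻¹) := by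
  induction n with
  | zero => simp
  | succ n ih =>
    rw [Finset.sum_range_succ]
    have hx : (1:ℝ) ≤ ((m + n : ℕ) : ℝ) := by exact_mod_cast (by omega : 1 ≤ m + n)
    have h : (((m + n : ℕ) : ℝ) ^ 2)⁻¹ ≤
        2 * (((m + n : ℕ) : ℝ)⁻¹ - ((m + (n + 1) : ℕ) : ℝ)⁻¹) := by
      have e : ((m + (n + 1) : ℕ) : ℝ) = ((m + n : ℕ) : ℝ) + 1 := by push_cast; ring
      rw [e]
      generalize ((m + n : ℕ) : ℝ) = y at hx
      have : 2 * (y⁻¹ - (y + 1)⁻¹) = 2 / (y * (y + 1)) := by field_simp; ring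
      rw [this, ← one_div, div_le_div_iff₀ (by positivity) (by positivity)]
      nlinarith
    linarith

/-- The sum $\sum_{k\ge m} k^{-2t}$ is of order $m^{1-2t}$, and conjugacy turns $(2t-1)/t$ into
$1+1/s$. This is where the exponent of the weight comes from. The bound $k^{-2t} \le
m^{-2(t-1)}k^{-2}$ reduces the estimate to a telescoping sum. -/
lemma tsum_inv_sq_rpow_le {s t : ℝ} (hst : s.HolderConjugate t) {m : ℕ} (hm : 1 ≤ m) :
    (∑' i : ℕ, ((((m + i : ℕ) : ℝ≥0∞) ^ 2)⁻¹) ^ t) ^ (1 / t) ≤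
      2 / (m : ℝ≥0∞) ^ (1 + 1 / s) := by
  have ht1 : 1 < t := hst.symm.lt
  have ht0 : 0 < t := hst.symm.pos
  have hm0 : (0:ℝ) < m := by exact_mod_cast hm
  have h1 : ∑' i : ℕ, ((((m + i : ℕ) : ℝ≥0∞) ^ 2)⁻¹) ^ t ≤
      ENNReal.ofReal (((m : ℝ) ^ 2)⁻¹ ^ (t - 1) * (2 * (m : ℝ)⁻¹)) := by
    refine ENNReal.tsum_le_of_sum_range_le fun n => ?_
    have hterm : ∀ i : ℕ, ((((m + i : ℕ) : ℝ≥0∞) ^ 2)⁻¹) ^ t =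
        ENNReal.ofReal (((((m + i : ℕ) : ℝ) ^ 2)⁻¹) ^ t) := by
      intro i
      have hpos : (0:ℝ) < ((m + i : ℕ) : ℝ) := by exact_mod_cast (by omega : 0 < m + i)
      rw [← ENNReal.ofReal_rpow_of_nonneg (by positivity) ht0.le,
        ENNReal.ofReal_inv_of_pos (by positivity), ENNReal.ofReal_pow (by positivity),
        ENNReal.ofReal_natCast]
    simp_rw [hterm]
    rw [← ENNReal.ofReal_sum_of_nonneg (fun i _ => by positivity)]
    refine ENNReal.ofReal_le_ofReal ?_
    calc ∑ i ∈ Finset.range n, ((((m + i : ℕ) : ℝ) ^ 2)⁻¹) ^ t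
        ≤ ∑ i ∈ Finset.range n, ((m : ℝ) ^ 2)⁻¹ ^ (t - 1) * (((m + i : ℕ) : ℝ) ^ 2)⁻¹ := by
          refine Finset.sum_le_sum fun i _ => ?_
          have hpos : (0:ℝ) < ((m + i : ℕ) : ℝ) := by exact_mod_cast (by omega : 0 < m + i)
          have hle : (m : ℝ) ≤ ((m + i : ℕ) : ℝ) := by exact_mod_cast Nat.le_add_right m i
          calc ((((m + i : ℕ) : ℝ) ^ 2)⁻¹) ^ t
              = ((((m + i : ℕ) : ℝ) ^ 2)⁻¹) ^ (t - 1) * (((m + i : ℕ) : ℝ) ^ 2)⁻¹ := by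
                rw [← Real.rpow_add_one (by positivity)]; simp
            _ ≤ _ := by
              gcongr
      _ ≤ _ := by
          rw [← Finset.mul_sum]
          gcongr
          have := sum_range_inv_sq_le hm n
          have h0 : (0:ℝ) ≤ ((m + n : ℕ) : ℝ)⁻¹ := by positivity
          linarith
  calc _ ≤ (ENNReal.ofReal (((m : ℝ) ^ 2)⁻¹ ^ (t - 1) * (2 * (m : ℝ)⁻¹))) ^ (1 / t) := by gcongr
    _ = ENNReal.ofReal (2 ^ (1 / t) * ((m : ℝ) ^ (1 + 1 / s))⁻¹) := by
      rw [ENNReal.ofReal_rpow_of_nonneg (by positivity) (by positivity)]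
      congr 1
      have e : ((m : ℝ) ^ 2)⁻¹ ^ (t - 1) * (2 * (m : ℝ)⁻¹) = 2 * (m : ℝ) ^ (-(2 * t - 1)) := by
        rw [← Real.rpow_natCast, ← Real.rpow_neg hm0.le, ← Real.rpow_mul hm0.le, mul_left_comm,
          ← Real.rpow_neg_one, ← Real.rpow_add hm0]
        congr 2
        push_cast; ring
      rw [e, Real.mul_rpow (by norm_num) (by positivity), ← Real.rpow_mul hm0.le,
        ← Real.rpow_neg hm0.le]
      congr 2
      have := hst.inv_add_inv_eq_one
      rw [one_div, one_div]
      have h2 : t * t⁻¹ = 1 := mul_inv_cancel₀ ht0.ne'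
      linear_combination (-2) * h2 + this
    _ ≤ ENNReal.ofReal (2 * ((m : ℝ) ^ (1 + 1 / s))⁻¹) := by
      refine ENNReal.ofReal_le_ofReal ?_
      gcongr
      calc (2:ℝ) ^ (1 / t) ≤ 2 ^ (1:ℝ) :=
            Real.rpow_le_rpow_of_exponent_le (by norm_num) (by rw [div_le_one ht0]; exact ht1.le)
        _ = 2 := by simp
    _ = _ := by
      rw [ENNReal.ofReal_mul (by norm_num), ENNReal.ofReal_inv_of_pos (by positivity),
        ← ENNReal.ofReal_rpow_of_pos hm0, ENNReal.ofReal_natCast, ENNReal.ofReal_ofNat]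
      exact (div_eq_mul_inv _ _).symm

/-- The weighted sum of a whole sequence, with weights flattened below `N`, is controlled by the
tail from `N` on. -/
lemma tsum_div_add_rpow_le_wTail (a : ℕ → ℝ≥0∞) (ha : ∀ l k, a l ≤ a (l + k) + a k) {s : ℝ}
    (hs : 1 ≤ s) {N : ℕ} (hN : 1 ≤ N) :
    ∑' l : ℕ, a l / ((N + l : ℕ) : ℝ≥0∞) ^ (1 + 1 / s) ≤ 51 * wTail a s N := by
  have hs0 : 0 < s := by linarith
  have hα : (0:ℝ) ≤ 1 + 1 / s := by positivity
  have hN0 : (N : ℝ≥0∞) ≠ 0 := by simpa using (by omega : N ≠ 0)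
  have hNr0 : (N : ℝ≥0∞) ^ (1 + 1 / s) ≠ 0 := by
    simp [ENNReal.rpow_eq_zero_iff, hN0]
  have hNrt : (N : ℝ≥0∞) ^ (1 + 1 / s) ≠ ∞ :=
    ENNReal.rpow_ne_top_of_nonneg hα (ENNReal.natCast_ne_top _)
  rw [← ENNReal.summable.sum_add_tsum_nat_add' (k := N)]
  have h1 : ∑ l ∈ Finset.range N, a l / ((N + l : ℕ) : ℝ≥0∞) ^ (1 + 1 / s) ≤ 50 * wTail a s N := by
    calc _ ≤ ∑ l ∈ Finset.range N,
          50 * (N : ℝ≥0∞) ^ (1 / s) * wTail a s N / (N : ℝ≥0∞) ^ (1 + 1 / s) := by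
          refine Finset.sum_le_sum fun l hl => ?_
          have hl := Finset.mem_range.1 hl
          gcongr
          · exact le_wTail a ha hs hN (by omega)
          · omega
      _ = (N : ℝ≥0∞) ^ (1 + 1 / s) * (50 * wTail a s N / (N : ℝ≥0∞) ^ (1 + 1 / s)) := by
          rw [Finset.sum_const, Finset.card_range, nsmul_eq_mul]
          nth_rw 2 [natCast_rpow_one_add hN]
          simp only [div_eq_mul_inv]
          ring
      _ = _ := ENNReal.mul_div_cancel hNr0 hNrt
  have h2 : ∑' l : ℕ, a (l + N) / ((N + (l + N) : ℕ) : ℝ≥0∞) ^ (1 + 1 / s) ≤ wTail a s N := by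
    refine ENNReal.tsum_le_tsum fun l => ?_
    rw [add_comm l N]
    gcongr
    omega
  calc _ ≤ 50 * wTail a s N + wTail a s N := add_le_add h1 h2
    _ = _ := by ring

end MartApprox

/-! ### The regularized tails $T_n$ by summation by parts -/

namespace MartApprox

namespace AdaptedShift

variable {V : Type*} [NormedAddCommGroup V] [NormedSpace ℝ V] (A : AdaptedShift V)

/-- The partial sum `∑_{j < m} innov (U ^ j x)`. -/
noncomputable def innovSum (x : V) (m : ℕ) : V :=
  ∑ j ∈ Finset.range m, A.innov ((A.U ^ (j : ℤ)) x)

lemma innovSum_succ (x : V) (m : ℕ) :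
    A.innovSum x (m + 1) = A.innovSum x m + A.innov ((A.U ^ (m : ℤ)) x) :=
  Finset.sum_range_succ _ _

lemma innov_zpow_S (x : V) (n l : ℕ) :
    A.innov ((A.U ^ (n : ℤ)) (A.S x l)) = A.innovSum x (n + 1 + l) - A.innovSum x (n + 1) := by
  simp only [innovSum, S, Finset.sum_range_add, map_sum, ← zpow_add_apply]
  rw [add_sub_cancel_left]
  refine Finset.sum_congr rfl fun i _ => ?_
  push_cast
  congr 3
  ring

/-- Past terms do not contribute to the innovation. -/
lemma innov_zpow_neg_S {x : V} (hx : A.Q x = x) (k r : ℕ) :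
    A.innov ((A.U ^ (-((k : ℤ) + 1))) (A.S x (k + 1 + r))) = A.innovSum x (r + 1) := by
  have h1 : A.innov ((A.U ^ (-((k : ℤ) + 1))) (A.S x (k + 1))) = A.innov x := by
    rw [S, Finset.sum_range_succ, map_add, map_add, A.zpow_neg_apply_zpow, map_sum, map_sum,
      Finset.sum_eq_zero, zero_add]
    intro i hi
    have hi := Finset.mem_range.1 hi
    obtain ⟨l, rfl⟩ := Nat.exists_eq_add_of_lt hi
    rw [← zpow_add_apply]
    convert A.innov_zpow_neg_succ hx l using 4
    push_cast
    ring
  have h2 := A.innov_zpow_S x 0 r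
  rw [S_add, map_add, map_add, h1]
  push_cast
  rw [A.zpow_neg_apply_zpow]
  simp only [Nat.cast_zero, zpow_zero, zero_add, LinearIsometryEquiv.coe_one, id_eq] at h2
  rw [h2, add_comm 1 r]
  simp [innovSum]

lemma norm_innov_zpow_le (n : ℕ) (v : V) :
    ‖A.innov ((A.U ^ (n : ℤ)) v)‖ ≤ 2 * ‖A.Q v‖ := by
  have h : ∀ n : ℕ, ‖A.Q ((A.U ^ (n : ℤ)) v)‖ ≤ ‖A.Q v‖ := fun n => by
    rw [← A.Q_zpow_Q]
    exact (A.norm_Q_le _).trans_eq (LinearIsometryEquiv.norm_map _ _)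
  have h1 := h n
  have h2 := h (n + 1)
  push_cast at h2
  rw [zpow_succ_apply] at h2
  rw [innov_apply]
  refine (norm_sub_le _ _).trans ?_
  rw [R_apply, LinearIsometryEquiv.norm_map]
  linarith

/-- The sequence `‖Q (S x l)‖`. -/
noncomputable def projNorm (x : V) (l : ℕ) : ℝ≥0∞ := ‖A.Q (A.S x l)‖ₑ

/-- The constant in the cotype inequality. -/
noncomputable def _root_.MartApprox.cotypeConst (s c : ℝ) : ℝ≥0∞ :=
  ENNReal.ofReal (2 * c⁻¹ ^ (1 / s))

/-- The terms of the Abel summation of `∑_{j > n} innov (U ^ j x) / (j + 1)`. -/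
noncomputable def abelTerm (x : V) (n l : ℕ) : V :=
  (((n + 1 + l : ℕ) : ℝ) * ((n + 1 + l : ℕ) + 1 : ℝ))⁻¹ • A.innov ((A.U ^ (n : ℤ)) (A.S x l))

/-- Abel summation, with $1/k - 1/(k+1) = 1/(k(k+1))$: the partial sums of the innovations are
$\mathcal P_0(U^n S_l)$, to which the cotype inequality applies. -/
lemma sum_range_eq_abelTerm (x : V) (n L : ℕ) :
    ∑ j ∈ Finset.range L,
        (((n + 1 + j : ℕ) : ℝ) + 1)⁻¹ • A.innov ((A.U ^ ((n + 1 + j : ℕ) : ℤ)) x) =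
      ((n + 1 + L : ℕ) : ℝ)⁻¹ • A.innov ((A.U ^ (n : ℤ)) (A.S x L)) +
        ∑ l ∈ Finset.range L, A.abelTerm x n l := by
  induction L with
  | zero => simp [S]
  | succ L ih =>
    rw [Finset.sum_range_succ, Finset.sum_range_succ, ih, abelTerm, innov_zpow_S, innov_zpow_S,
      ← add_assoc (n + 1) L 1, A.innovSum_succ x (n + 1 + L)]
    have hy : (0:ℝ) < ((n + 1 + L : ℕ) : ℝ) := by positivity
    have e : ((n + 1 + L + 1 : ℕ) : ℝ) = ((n + 1 + L : ℕ) : ℝ) + 1 := by push_cast; ring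
    rw [e]
    generalize ((n + 1 + L : ℕ) : ℝ) = y at hy
    have e2 : y⁻¹ = (y + 1)⁻¹ + (y * (y + 1))⁻¹ := by field_simp
    rw [e2]
    module

lemma enorm_abelTerm_le (x : V) (n l : ℕ) :
    ‖A.abelTerm x n l‖ₑ ≤
      ‖A.innov ((A.U ^ (n : ℤ)) (A.S x l))‖ₑ * (((n + 1 + l : ℕ) : ℝ≥0∞) ^ 2)⁻¹ := by
  have hy : (0:ℝ) < ((n + 1 + l : ℕ) : ℝ) := by positivity
  rw [abelTerm, enorm_smul, mul_comm]
  gcongr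
  rw [Real.enorm_of_nonneg (by positivity), ← ENNReal.ofReal_natCast, ← ENNReal.ofReal_pow hy.le,
    ← ENNReal.ofReal_inv_of_pos (by positivity)]
  refine ENNReal.ofReal_le_ofReal ?_
  gcongr
  nlinarith

variable {A} {x : V} {s c : ℝ}

/-- The order of summation is exchanged. For fixed $l$, Hölder's inequality in $i$ pairs the
$\ell^s$ norm of the innovations of $S_l$, controlled by $\|QS_l\|$, with the conjugate norm of the
inverse squares. The constant is $102 = 2\cdot 51$. -/
lemma tsum_tsum_enorm_abelTerm_le (hs : 1 < s) (hc : 0 < c) (hV : ConvexType V s c) (m : ℕ) :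
    ∑' i : ℕ, ∑' l : ℕ, ‖A.abelTerm x (m + i) l‖ₑ ≤
      102 * cotypeConst s c * wTail (A.projNorm x) s (m + 1) := by
  have hst : s.HolderConjugate (s.conjExponent) := .conjExponent hs
  have hs0 : 0 < s := by linarith
  calc ∑' i : ℕ, ∑' l : ℕ, ‖A.abelTerm x (m + i) l‖ₑ
      = ∑' l : ℕ, ∑' i : ℕ, ‖A.abelTerm x (m + i) l‖ₑ := ENNReal.tsum_comm
    _ ≤ ∑' l : ℕ, ∑' i : ℕ, ‖A.innov ((A.U ^ ((m + i : ℕ) : ℤ)) (A.S x l))‖ₑ *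
          (((m + 1 + l + i : ℕ) : ℝ≥0∞) ^ 2)⁻¹ := by
        refine ENNReal.tsum_le_tsum fun l => ENNReal.tsum_le_tsum fun i => ?_
        have := A.enorm_abelTerm_le x (m + i) l
        rwa [show m + i + 1 + l = m + 1 + l + i by ring] at this
    _ ≤ ∑' l : ℕ, (cotypeConst s c * A.projNorm x l) *
          (2 / ((m + 1 + l : ℕ) : ℝ≥0∞) ^ (1 + 1 / s)) := by
        refine ENNReal.tsum_le_tsum fun l => (tsum_mul_le_Lp_mul_Lq _ _ hst).trans ?_
        refine mul_le_mul' ?_ (tsum_inv_sq_rpow_le hst (by omega))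
        refine le_trans ?_ (tsum_enorm_innov_zpow_rpow_le hs0 hc hV (A.S x l))
        refine ENNReal.rpow_le_rpow ?_ (by positivity)
        exact ENNReal.tsum_comp_le_tsum_of_injective (f := fun j => m + j) (add_right_injective m)
          (fun j : ℕ => ‖A.innov ((A.U ^ (j : ℤ)) (A.S x l))‖ₑ ^ s)
    _ = 2 * cotypeConst s c *
          ∑' l : ℕ, A.projNorm x l / ((m + 1 + l : ℕ) : ℝ≥0∞) ^ (1 + 1 / s) := by
        rw [← ENNReal.tsum_mul_left]
        refine tsum_congr fun l => ?_
        simp only [div_eq_mul_inv]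
        ring
    _ ≤ 2 * cotypeConst s c * (51 * wTail (A.projNorm x) s (m + 1)) := by
        gcongr
        exact tsum_div_add_rpow_le_wTail _ (A.norm_Q_S_le x) hs.le (by omega)
    _ = _ := by ring

/-- `le_wTail` with $N = l = L$ gives growth $L^{1/s} \le L^{1/2}$. Any power below 1 would suffice
to kill the boundary term of the Abel summation. -/
lemma projNorm_le_sqrt (hs : 2 ≤ s) (hfin : wTail (A.projNorm x) s 1 < ∞) :
    ∃ B : ℝ, ∀ L : ℕ, 1 ≤ L → ‖A.Q (A.S x L)‖ ≤ B * (L : ℝ) ^ (2⁻¹ : ℝ) := by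
  refine ⟨(50 * wTail (A.projNorm x) s 1).toReal, fun L hL => ?_⟩
  have h50 : 50 * wTail (A.projNorm x) s 1 ≠ ∞ := ENNReal.mul_ne_top (by norm_num) hfin.ne
  have hs0 : 0 < s := by linarith
  have h : A.projNorm x L ≤ (50 * wTail (A.projNorm x) s 1) * (L : ℝ≥0∞) ^ (2⁻¹ : ℝ) := by
    calc A.projNorm x L ≤ 50 * (L : ℝ≥0∞) ^ (1 / s) * wTail (A.projNorm x) s L :=
          le_wTail _ (A.norm_Q_S_le x) (by linarith) hL (by omega)
      _ ≤ 50 * (L : ℝ≥0∞) ^ (2⁻¹ : ℝ) * wTail (A.projNorm x) s 1 := by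
          gcongr
          · exact_mod_cast hL
          · rw [one_div]; gcongr
          · exact wTail_anti _ _ hL
      _ = _ := by ring
  have ht : (50 * wTail (A.projNorm x) s 1) * (L : ℝ≥0∞) ^ (2⁻¹ : ℝ) ≠ ∞ :=
    ENNReal.mul_ne_top h50 (ENNReal.rpow_ne_top_of_nonneg (by norm_num) (ENNReal.natCast_ne_top _))
  have := ENNReal.toReal_mono ht h
  rwa [projNorm, toReal_enorm, ENNReal.toReal_mul, ← ENNReal.toReal_rpow,
    ENNReal.toReal_natCast] at this

lemma tendsto_boundary_term (hs : 2 ≤ s) (hfin : wTail (A.projNorm x) s 1 < ∞) (n : ℕ) :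
    Tendsto (fun L : ℕ => ((n + 1 + L : ℕ) : ℝ)⁻¹ • A.innov ((A.U ^ (n : ℤ)) (A.S x L))) atTop
      (𝓝 0) := by
  obtain ⟨B, hB⟩ := projNorm_le_sqrt hs hfin
  have hlim : Tendsto (fun L : ℕ => 2 * B * (L : ℝ) ^ (-(2⁻¹ : ℝ))) atTop (𝓝 0) := by
    have := ((tendsto_rpow_neg_atTop (by norm_num : (0:ℝ) < 2⁻¹)).comp
      tendsto_natCast_atTop_atTop).const_mul (2 * B)
    simpa using this
  refine squeeze_zero_norm' ?_ hlim
  filter_upwards [eventually_ge_atTop 1] with L hL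
  have hL0 : (0:ℝ) < L := by exact_mod_cast hL
  have h1 := (A.norm_innov_zpow_le n (A.S x L)).trans
    (mul_le_mul_of_nonneg_left (hB L hL) zero_le_two)
  rw [norm_smul, norm_inv, Real.norm_of_nonneg (by positivity)]
  calc _ ≤ (L : ℝ)⁻¹ * (2 * (B * (L : ℝ) ^ (2⁻¹ : ℝ))) := by
        gcongr
        omega
    _ = 2 * B * ((L : ℝ) ^ (-1 : ℝ) * (L : ℝ) ^ (2⁻¹ : ℝ)) := by rw [Real.rpow_neg_one]; ring
    _ = _ := by rw [← Real.rpow_add hL0]; norm_num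

lemma innov_innov (v : V) : A.innov (A.innov v) = A.innov v := by
  rw [innov_apply, Q_innov, R_innov, sub_zero]

/-- The regularized tail series `∑_{k ≥ n} innov (U ^ k x) / (k + 1)`. -/
noncomputable def regTail (A : AdaptedShift V) (x : V) : ℕ → V
  -- `abelTerm x n` accounts for the indices $k \ge n+1$ only, so the term $k = 0$ is added by hand.
  | 0 => A.innov x + ∑' l, A.abelTerm x 0 l
  | n + 1 => ∑' l, A.abelTerm x n l

lemma tsum_enorm_regTail_le (hs : 1 < s) (hc : 0 < c) (hV : ConvexType V s c) {N : ℕ}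
    (hN : 1 ≤ N) :
    ∑' i : ℕ, ‖A.regTail x (N + i)‖ₑ ≤ 102 * cotypeConst s c * wTail (A.projNorm x) s N := by
  obtain ⟨m, rfl⟩ := Nat.exists_eq_add_of_le' hN
  refine le_trans (ENNReal.tsum_le_tsum fun i => ?_) (tsum_tsum_enorm_abelTerm_le hs hc hV m)
  rw [show m + 1 + i = m + i + 1 by ring]
  exact enorm_tsum_le_tsum_enorm

lemma summable_norm_regTail (hs : 1 < s) (hc : 0 < c) (hV : ConvexType V s c)
    (hfin : wTail (A.projNorm x) s 1 < ∞) : Summable fun n => ‖A.regTail x n‖ := by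
  rw [← summable_nat_add_iff 1, ← tsum_enorm_ne_top_iff_summable_norm]
  have h := tsum_enorm_regTail_le (A := A) (x := x) hs hc hV le_rfl
  simp only [add_comm 1] at h
  refine (h.trans_lt (ENNReal.mul_lt_top (ENNReal.mul_lt_top (by norm_num) ?_) hfin)).ne
  exact ENNReal.ofReal_lt_top

variable [CompleteSpace V]

lemma tendsto_regTail (hs : 2 ≤ s) (hc : 0 < c) (hV : ConvexType V s c)
    (hfin : wTail (A.projNorm x) s 1 < ∞) (n : ℕ) :
    Tendsto (fun L => ∑ j ∈ Finset.range L,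
      (((n + j : ℕ) : ℝ) + 1)⁻¹ • A.innov ((A.U ^ ((n + j : ℕ) : ℤ)) x)) atTop
      (𝓝 (A.regTail x n)) := by
  have hsucc : ∀ n : ℕ, Tendsto (fun L => ∑ j ∈ Finset.range L,
      (((n + 1 + j : ℕ) : ℝ) + 1)⁻¹ • A.innov ((A.U ^ ((n + 1 + j : ℕ) : ℤ)) x)) atTop
      (𝓝 (A.regTail x (n + 1))) := by
    intro n
    have hsum : Summable (A.abelTerm x n) := by
      refine Summable.of_enorm ?_
      have h := tsum_tsum_enorm_abelTerm_le (A := A) (x := x) (by linarith) hc hV 0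
      have h2 := (ENNReal.le_tsum (f := fun i => ∑' l : ℕ, ‖A.abelTerm x (0 + i) l‖ₑ) n).trans h
      rw [zero_add] at h2
      refine (h2.trans_lt (ENNReal.mul_lt_top (ENNReal.mul_lt_top (by norm_num) ?_) hfin)).ne
      exact ENNReal.ofReal_lt_top
    simp_rw [sum_range_eq_abelTerm]
    have e : A.regTail x (n + 1) = 0 + ∑' l, A.abelTerm x n l := (zero_add _).symm
    rw [e]
    exact (tendsto_boundary_term hs hfin n).add hsum.hasSum.tendsto_sum_nat
  cases n with
  | succ n => exact hsucc n
  | zero =>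
    rw [← tendsto_add_atTop_iff_nat 1]
    simp_rw [Finset.sum_range_succ']
    have h := (hsucc 0).const_add (A.innov x)
    have e : A.regTail x 0 = A.innov x + A.regTail x (0 + 1) := rfl
    rw [e]
    refine h.congr fun L => ?_
    rw [add_comm]
    congr 1
    · refine Finset.sum_congr rfl fun j _ => ?_
      rw [show 0 + (j + 1) = 0 + 1 + j by ring]
    · simp

lemma regTail_sub (hs : 2 ≤ s) (hc : 0 < c) (hV : ConvexType V s c)
    (hfin : wTail (A.projNorm x) s 1 < ∞) (n : ℕ) :
    A.regTail x n = A.regTail x (n + 1) + ((n : ℝ) + 1)⁻¹ • A.innov ((A.U ^ (n : ℤ)) x) := by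
  have h1 := (tendsto_add_atTop_iff_nat 1).2 (tendsto_regTail hs hc hV hfin n)
  have h2 := (tendsto_regTail hs hc hV hfin (n + 1)).add_const
    (((n : ℝ) + 1)⁻¹ • A.innov ((A.U ^ (n : ℤ)) x))
  refine tendsto_nhds_unique h1 (h2.congr fun L => ?_)
  rw [Finset.sum_range_succ']
  congr 1
  refine Finset.sum_congr rfl fun j _ => ?_
  rw [show n + (j + 1) = n + 1 + j by ring]

/-- In $T_0 + \dots + T_{M-1}$ the term $\mathcal P_0(X_k)/(k+1)$ occurs $k+1$ times if $k < M$ and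
$M$ times otherwise. The weights thus cancel on the first $M$ innovations. -/
lemma sum_range_regTail (hs : 2 ≤ s) (hc : 0 < c) (hV : ConvexType V s c)
    (hfin : wTail (A.projNorm x) s 1 < ∞) (M : ℕ) :
    ∑ m ∈ Finset.range M, A.regTail x m = A.innovSum x M + (M : ℝ) • A.regTail x M := by
  induction M with
  | zero => simp [innovSum]
  | succ M ih =>
    rw [Finset.sum_range_succ, ih, innovSum_succ, regTail_sub hs hc hV hfin M]
    have h : (M : ℝ) + 1 ≠ 0 := by positivity
    push_cast
    have e : A.innov ((A.U ^ (M : ℤ)) x) =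
        ((M : ℝ) + 1) • ((M : ℝ) + 1)⁻¹ • A.innov ((A.U ^ (M : ℤ)) x) := by
      rw [smul_inv_smul₀ h]
    nth_rw 3 [e]
    module

lemma innov_regTail (hs : 2 ≤ s) (hc : 0 < c) (hV : ConvexType V s c)
    (hfin : wTail (A.projNorm x) s 1 < ∞) (n : ℕ) :
    A.innov (A.regTail x n) = A.regTail x n := by
  have h := tendsto_regTail hs hc hV hfin n
  have h2 := (A.innov.continuous.tendsto _).comp h
  refine tendsto_nhds_unique h2 (h.congr fun L => ?_)
  simp [map_sum, innov_innov]

end AdaptedShift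

end MartApprox

/-! ### The approximating martingale -/

namespace MartApprox

namespace AdaptedShift

variable {V : Type*} [NormedAddCommGroup V] [NormedSpace ℝ V] {A : AdaptedShift V}
  {x : V} {s c : ℝ}

/-- The generator `∑_n ∑_{k ≥ n} innov (U ^ k x) / (k + 1)` of the approximating martingale. -/
noncomputable def generator (A : AdaptedShift V) (x : V) : V := ∑' n, A.regTail x n

lemma enorm_sum_zpow_le {C : ℝ} (hs : 0 < s) (hC : 0 ≤ C) (hV : SmoothType V s C) {d : ℕ → V}
    (hd : ∀ k, A.innov (d k) = d k) {n : ℕ} {B : ℝ≥0∞} (hB : B ≠ ∞)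
    (hdB : ∀ k < n, ‖d k‖ₑ ≤ B) :
    ‖∑ k ∈ Finset.range n, (A.U ^ ((k : ℤ) + 1)) (d k)‖ₑ ≤
      ENNReal.ofReal (C ^ (1 / s)) * (n : ℝ≥0∞) ^ (1 / s) * B := by
  lift B to ℝ≥0 using hB
  have hreal : ∀ k < n, ‖d k‖ ≤ B := fun k hk => by
    have := hdB k hk
    rwa [enorm_eq_nnnorm, ENNReal.coe_le_coe] at this
  have h := norm_sum_zpow_rpow_le (A := A) hs hV (d := d)
    (fun k => by rw [← hd k, A.Q_innov]) (fun k => by rw [← hd k, A.R_innov]) n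
  set z := ∑ k ∈ Finset.range n, (A.U ^ ((k : ℤ) + 1)) (d k)
  have h2 : ‖z‖ ^ s ≤ C * (n * (B : ℝ) ^ s) := by
    refine h.trans ?_
    gcongr
    calc ∑ k ∈ Finset.range n, ‖d k‖ ^ s ≤ ∑ k ∈ Finset.range n, (B : ℝ) ^ s := by
          refine Finset.sum_le_sum fun k hk => ?_
          have := hreal k (Finset.mem_range.1 hk)
          gcongr
      _ = _ := by simp
  have h3 : ‖z‖ ≤ C ^ (1 / s) * (n : ℝ) ^ (1 / s) * B := by
    calc ‖z‖ = (‖z‖ ^ s) ^ (1 / s) := by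
          rw [← Real.rpow_mul (norm_nonneg _), mul_one_div_cancel hs.ne', Real.rpow_one]
      _ ≤ (C * (n * (B : ℝ) ^ s)) ^ (1 / s) := by gcongr
      _ = _ := by
          rw [Real.mul_rpow hC (by positivity), Real.mul_rpow (by positivity) (by positivity),
            ← Real.rpow_mul B.coe_nonneg, mul_one_div_cancel hs.ne', Real.rpow_one, mul_assoc]
  rw [← ofReal_norm]
  refine (ENNReal.ofReal_le_ofReal h3).trans_eq ?_
  rw [ENNReal.ofReal_mul (by positivity), ENNReal.ofReal_mul (by positivity),
    ← ENNReal.ofReal_rpow_of_nonneg (Nat.cast_nonneg n) (by positivity),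
    ENNReal.ofReal_natCast, ENNReal.ofReal_coe_nnreal]

/-- Hölder's inequality over the block gives $N^{1-1/s}$ times the cotype bound $\|QS_j\|$, and
`le_wTail` supplies the missing $N^{1/s}$. Averaging over a block gains exactly this factor over a
bound for single terms. -/
lemma sum_block_enorm_innov_le (hs : 1 < s) (hc : 0 < c) (hV : ConvexType V s c) {N j : ℕ}
    (hN : 1 ≤ N) (hj : j ≤ 3 * N) (m : ℕ) :
    ∑ i ∈ Finset.range N, ‖A.innov ((A.U ^ ((m + i : ℕ) : ℤ)) (A.S x j))‖ₑ ≤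
      N * (50 * cotypeConst s c * wTail (A.projNorm x) s N) := by
  have hst : s.HolderConjugate (s.conjExponent) := .conjExponent hs
  have hs0 : 0 < s := by linarith
  have hN0 : (N : ℝ≥0∞) ≠ 0 := by simpa using (by omega : N ≠ 0)
  have h := ENNReal.inner_le_Lp_mul_Lq (Finset.range N)
    (fun i => ‖A.innov ((A.U ^ ((m + i : ℕ) : ℤ)) (A.S x j))‖ₑ) (fun _ => 1) hst
  simp only [mul_one, ENNReal.one_rpow, Finset.sum_const, Finset.card_range, nsmul_eq_mul] at h
  have h1 : (∑ i ∈ Finset.range N,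
      ‖A.innov ((A.U ^ ((m + i : ℕ) : ℤ)) (A.S x j))‖ₑ ^ s) ^ (1 / s) ≤
      cotypeConst s c * A.projNorm x j := by
    refine le_trans ?_ (tsum_enorm_innov_zpow_rpow_le hs0 hc hV (A.S x j))
    refine ENNReal.rpow_le_rpow ((ENNReal.sum_le_tsum _).trans ?_) (by positivity)
    exact ENNReal.tsum_comp_le_tsum_of_injective (f := fun j => m + j) (add_right_injective m)
      (fun i : ℕ => ‖A.innov ((A.U ^ (i : ℤ)) (A.S x j))‖ₑ ^ s)
  calc _ ≤ cotypeConst s c * A.projNorm x j * (N : ℝ≥0∞) ^ (1 / s.conjExponent) :=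
        h.trans (by gcongr)
    _ ≤ cotypeConst s c * (50 * (N : ℝ≥0∞) ^ (1 / s) * wTail (A.projNorm x) s N) *
          (N : ℝ≥0∞) ^ (1 / s.conjExponent) := by
        gcongr
        exact le_wTail _ (A.norm_Q_S_le x) hs.le hN hj
    _ = (N : ℝ≥0∞) ^ (1 / s + 1 / s.conjExponent) *
          (50 * cotypeConst s c * wTail (A.projNorm x) s N) := by
        rw [ENNReal.rpow_add _ _ hN0 (ENNReal.natCast_ne_top _)]; ring
    _ = _ := by
        rw [one_div, one_div, hst.inv_add_inv_eq_one, ENNReal.rpow_one]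

/-- The abstract form of the $\mathcal F_n$-measurability of $S_n$. -/
lemma Q_zpow_neg_S (hx : A.Q x = x) (n : ℕ) :
    A.Q ((A.U ^ (-(n : ℤ))) (A.S x n)) = (A.U ^ (-(n : ℤ))) (A.S x n) := by
  simp only [S, map_sum]
  refine Finset.sum_congr rfl fun k hk => ?_
  obtain ⟨l, rfl⟩ := Nat.exists_eq_add_of_lt (Finset.mem_range.1 hk)
  rw [← zpow_add_apply]
  have e : -((k + l + 1 : ℕ) : ℤ) + ((k : ℤ) + 1) = -(l : ℤ) := by push_cast; ring
  rw [e, A.Q_zpow_neg hx]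

/-- Decomposition of `E_n y` into innovations. -/
lemma zpow_Q_zpow_neg_eq (y : V) (n : ℕ) :
    (A.U ^ (n : ℤ)) (A.Q ((A.U ^ (-(n : ℤ))) y)) = A.Q y +
      ∑ k ∈ Finset.range n, (A.U ^ ((k : ℤ) + 1)) (A.innov ((A.U ^ (-((k : ℤ) + 1))) y)) := by
  induction n with
  | zero => simp
  | succ n ih =>
    rw [Finset.sum_range_succ, ← add_assoc, ← ih, innov_apply, map_sub]
    push_cast
    have e : (A.U ^ ((n : ℤ) + 1)) (A.R ((A.U ^ (-((n : ℤ) + 1))) y)) =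
        (A.U ^ (n : ℤ)) (A.Q ((A.U ^ (-(n : ℤ))) y)) := by
      rw [R_apply, ← zpow_succ_apply, A.zpow_add_apply n 1, zpow_one,
        LinearIsometryEquiv.apply_symm_apply, neg_add, neg_add_cancel_right]
    rw [e]
    abel

variable [CompleteSpace V]

lemma generator_eq (hs : 2 ≤ s) (hc : 0 < c) (hV : ConvexType V s c)
    (hfin : wTail (A.projNorm x) s 1 < ∞) (M : ℕ) :
    A.generator x = A.innovSum x M + (M : ℝ) • A.regTail x M + ∑' i, A.regTail x (M + i) := by
  have h := (summable_norm_regTail (by linarith) hc hV hfin).of_norm.sum_add_tsum_nat_add M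
  rw [generator, ← h, sum_range_regTail hs hc hV hfin]
  simp only [add_comm M]

lemma innov_generator (hs : 2 ≤ s) (hc : 0 < c) (hV : ConvexType V s c)
    (hfin : wTail (A.projNorm x) s 1 < ∞) : A.innov (A.generator x) = A.generator x := by
  have h := (summable_norm_regTail (by linarith) hc hV hfin).of_norm
  rw [generator, A.innov.map_tsum h]
  exact tsum_congr fun n => innov_regTail hs hc hV hfin n

/-- By `generator_eq` with $M = N+i$, each difference splits into the $j$ innovations past index
$N+i-1$, the term $(N+i)T_{N+i}$ and the remaining tail of the series of $T$. Relative to $N$, the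
block sums contribute $50$, $2\cdot 102$ and $102$, which add up to $356$. -/
lemma enorm_sum_block_sub_generator_le (hs : 2 ≤ s) (hc : 0 < c) (hV : ConvexType V s c)
    (hfin : wTail (A.projNorm x) s 1 < ∞) {N j : ℕ} (hN : 1 ≤ N) (hj : j ≤ 3 * N) :
    ‖∑ i ∈ Finset.range N, (A.innovSum x (N + i + j) - A.generator x)‖ₑ ≤
      N * (356 * cotypeConst s c * wTail (A.projNorm x) s N) := by
  have hs1 : 1 < s := by linarith
  set W := wTail (A.projNorm x) s N
  set K := cotypeConst s c
  obtain ⟨m, hm⟩ := Nat.exists_eq_add_of_le' hN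
  have hterm : ∀ i, A.innovSum x (N + i + j) - A.generator x =
      A.innov ((A.U ^ ((m + i : ℕ) : ℤ)) (A.S x j)) - ((N + i : ℕ) : ℝ) • A.regTail x (N + i) -
        ∑' k, A.regTail x (N + i + k) := by
    intro i
    rw [innov_zpow_S, generator_eq hs hc hV hfin (N + i), show m + i + 1 = N + i by omega]
    abel
  have htail : ∑' i : ℕ, ‖A.regTail x (N + i)‖ₑ ≤ 102 * K * W :=
    tsum_enorm_regTail_le hs1 hc hV hN
  have h2 : ∑ i ∈ Finset.range N, ‖((N + i : ℕ) : ℝ) • A.regTail x (N + i)‖ₑ ≤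
      N * (2 * (102 * K * W)) := by
    calc _ ≤ ∑ i ∈ Finset.range N, N * 2 * ‖A.regTail x (N + i)‖ₑ := by
          refine Finset.sum_le_sum fun i hi => ?_
          have hi := Finset.mem_range.1 hi
          rw [enorm_smul, Real.enorm_of_nonneg (by positivity), ENNReal.ofReal_natCast]
          gcongr
          exact_mod_cast (by omega : N + i ≤ N * 2)
      _ = N * (2 * ∑ i ∈ Finset.range N, ‖A.regTail x (N + i)‖ₑ) := by
          rw [← Finset.mul_sum, mul_assoc]
      _ ≤ _ := by
          gcongr
          exact (ENNReal.sum_le_tsum _).trans htail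
  have h3 : ∑ i ∈ Finset.range N, ‖∑' k, A.regTail x (N + i + k)‖ₑ ≤ N * (102 * K * W) := by
    calc _ ≤ ∑ i ∈ Finset.range N, 102 * K * W := by
          refine Finset.sum_le_sum fun i _ => enorm_tsum_le_tsum_enorm.trans ?_
          refine (tsum_enorm_regTail_le hs1 hc hV (by omega)).trans ?_
          gcongr
          exact wTail_anti _ _ (by omega)
      _ = _ := by simp
  calc _ ≤ ∑ i ∈ Finset.range N, ‖A.innovSum x (N + i + j) - A.generator x‖ₑ := enorm_sum_le _ _
    _ ≤ ∑ i ∈ Finset.range N, (‖A.innov ((A.U ^ ((m + i : ℕ) : ℤ)) (A.S x j))‖ₑ +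
          ‖((N + i : ℕ) : ℝ) • A.regTail x (N + i)‖ₑ + ‖∑' k, A.regTail x (N + i + k)‖ₑ) := by
        refine Finset.sum_le_sum fun i _ => ?_
        rw [hterm]
        exact enorm_sub_le.trans (add_le_add_left enorm_sub_le _)
    _ ≤ N * (50 * K * W) + N * (2 * (102 * K * W)) + N * (102 * K * W) := by
        rw [Finset.sum_add_distrib, Finset.sum_add_distrib]
        exact add_le_add (add_le_add (sum_block_enorm_innov_le hs1 hc hV hN hj m) h2) h3
    _ = _ := by ring

/-- The constant in the approximation theorem. -/
noncomputable def _root_.MartApprox.approxConst (s c s' C : ℝ) : ℝ≥0∞ :=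
  100 + ENNReal.ofReal (C ^ (1 / s')) * (356 * cotypeConst s c)

/-- The horizon $N$ balances the two errors: `hpow` keeps the boundary terms, of size $N^{1/s}$,
below the martingale bound $n^{1/s'}$. -/
theorem enorm_S_sub_S_generator_le (hx : A.Q x = x) (hs : 2 ≤ s) (hc : 0 < c)
    (hV : ConvexType V s c) {s' C : ℝ} (hs' : 0 < s') (hC : 0 ≤ C) (hS : SmoothType V s' C)
    (hfin : wTail (A.projNorm x) s 1 < ∞) {n N : ℕ} (hn : 1 ≤ n) (hnN : n ≤ N)
    (hpow : (N : ℝ≥0∞) ^ (1 / s) ≤ (n : ℝ≥0∞) ^ (1 / s')) :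
    ‖A.S x n - A.S (A.generator x) n‖ₑ ≤
      approxConst s c s' C * (n : ℝ≥0∞) ^ (1 / s') * wTail (A.projNorm x) s N := by
  have hN : 1 ≤ N := hn.trans hnN
  have hNE0 : (N : ℝ≥0∞) ≠ 0 := by simpa using (by omega : N ≠ 0)
  have hNR : (N : ℝ) ≠ 0 := by simpa using (by omega : N ≠ 0)
  set W := wTail (A.projNorm x) s N with hW
  set D := A.generator x with hD
  have hWfin : W ≠ ∞ := ((wTail_anti _ _ hN).trans_lt hfin).ne
  set z : V := (N : ℝ)⁻¹ • ∑ i ∈ Finset.range N, A.S x (N + i) with hz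
  set y : V := (N : ℝ)⁻¹ • ∑ i ∈ Finset.range N, A.S x (n + (N + i)) with hy
  have hyz : y = A.S x n + (A.U ^ (n : ℤ)) z := by
    rw [hy, hz, map_smul, map_sum]
    simp_rw [S_add]
    rw [Finset.sum_add_distrib, smul_add, Finset.sum_const, Finset.card_range,
      ← Nat.cast_smul_eq_nsmul ℝ, inv_smul_smul₀ hNR]
  have havg : ∀ (f : ℕ → V) (B : ℝ≥0∞), ‖∑ i ∈ Finset.range N, f i‖ₑ ≤ N * B →
      ‖(N : ℝ)⁻¹ • ∑ i ∈ Finset.range N, f i‖ₑ ≤ B := by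
    intro f B h
    refine (ENNReal.mul_le_mul_iff_right hNE0 (ENNReal.natCast_ne_top N)).1 (le_trans ?_ h)
    rw [← ENNReal.ofReal_natCast, ← Real.enorm_of_nonneg (Nat.cast_nonneg N), ← enorm_smul,
      smul_inv_smul₀ hNR]
  -- The indices $r+N+i$ stay below $3N$, the range allowed by `le_wTail`; $r = n$ and $r = 0$ give
  -- the bounds for $y$ and $z$.
  have hQsum : ∀ r ≤ N, ‖A.Q ((N : ℝ)⁻¹ • ∑ i ∈ Finset.range N, A.S x (r + (N + i)))‖ₑ ≤
      50 * (n : ℝ≥0∞) ^ (1 / s') * W := by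
    intro r hr
    rw [map_smul, map_sum]
    refine havg _ _ ((enorm_sum_le _ _).trans ?_)
    calc _ ≤ ∑ i ∈ Finset.range N, 50 * (n : ℝ≥0∞) ^ (1 / s') * W := by
          refine Finset.sum_le_sum fun i hi => ?_
          have hi := Finset.mem_range.1 hi
          refine (le_wTail (A.projNorm x) (A.norm_Q_S_le x) (by linarith : 1 ≤ s) hN
            (by omega)).trans ?_
          gcongr
      _ = _ := by simp
  have hQy : ‖A.Q y‖ₑ ≤ 50 * (n : ℝ≥0∞) ^ (1 / s') * W := hQsum n hnN
  have hQz : ‖A.Q z‖ₑ ≤ 50 * (n : ℝ≥0∞) ^ (1 / s') * W := by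
    simpa only [zero_add] using hQsum 0 (Nat.zero_le _)
  have hdec : A.S x n - A.S D n = A.Q y - (A.U ^ (n : ℤ)) (A.Q z) +
      ∑ k ∈ Finset.range n,
        (A.U ^ ((k : ℤ) + 1)) (A.innov ((A.U ^ (-((k : ℤ) + 1))) y) - D) := by
    have h := A.zpow_Q_zpow_neg_eq y n
    have h1 : (A.U ^ (n : ℤ)) (A.Q ((A.U ^ (-(n : ℤ))) y)) =
        A.S x n + (A.U ^ (n : ℤ)) (A.Q z) := by
      rw [hyz, map_add, map_add, Q_zpow_neg_S hx, A.zpow_neg_apply_zpow, map_add,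
        A.zpow_apply_zpow_neg]
    rw [h1] at h
    simp only [map_sub, Finset.sum_sub_distrib]
    rw [eq_sub_of_add_eq h]
    simp only [S]
    abel
  have hdk : ∀ k < n, ‖A.innov ((A.U ^ (-((k : ℤ) + 1))) y) - D‖ₑ ≤
      356 * cotypeConst s c * W := by
    intro k hk
    have e : A.innov ((A.U ^ (-((k : ℤ) + 1))) y) - D = (N : ℝ)⁻¹ • ∑ i ∈ Finset.range N,
        (A.innovSum x (N + i + (n - k)) - D) := by
      rw [Finset.sum_sub_distrib, smul_sub, Finset.sum_const, Finset.card_range,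
        ← Nat.cast_smul_eq_nsmul ℝ, inv_smul_smul₀ hNR, hy]
      simp only [map_smul, map_sum]
      congr 2
      refine Finset.sum_congr rfl fun i _ => ?_
      -- Seen from time $k+1$, only the present and future terms of $S_{n+N+i}$ have an innovation,
      -- which leaves $N+i+(n-k)$ of them.
      rw [show n + (N + i) = k + 1 + (N + i + (n - k) - 1) by omega, A.innov_zpow_neg_S hx]
      congr 1
      omega
    rw [e]
    exact havg _ _ (enorm_sum_block_sub_generator_le hs hc hV hfin hN (by omega))
  have htype := enorm_sum_zpow_le (A := A) hs' hC hS (n := n)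
    (d := fun k => A.innov ((A.U ^ (-((k : ℤ) + 1))) y) - D)
    (fun k => by rw [map_sub, innov_innov, hD, innov_generator hs hc hV hfin])
    (ENNReal.mul_ne_top (ENNReal.mul_ne_top (by norm_num) ENNReal.ofReal_ne_top) hWfin) hdk
  rw [hdec]
  calc _ ≤ ‖A.Q y‖ₑ + ‖(A.U ^ (n : ℤ)) (A.Q z)‖ₑ + _ :=
        (enorm_add_le _ _).trans (add_le_add_left enorm_sub_le _)
    _ ≤ 50 * (n : ℝ≥0∞) ^ (1 / s') * W + 50 * (n : ℝ≥0∞) ^ (1 / s') * W +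
          ENNReal.ofReal (C ^ (1 / s')) * (n : ℝ≥0∞) ^ (1 / s') * (356 * cotypeConst s c * W) := by
        refine add_le_add (add_le_add hQy (le_trans (le_of_eq ?_) hQz)) htype
        rw [← ofReal_norm, LinearIsometryEquiv.norm_map, ofReal_norm]
    _ = _ := by
        rw [approxConst]; ring

end AdaptedShift

end MartApprox

/-! ### Two-point inequalities in a Hilbert space -/

namespace MartApprox

section TwoPoint

lemma rpow_midpoint_le {a b r : ℝ} (ha : 0 ≤ a) (hb : 0 ≤ b) (hr : 1 ≤ r) :
    2 * ((a + b) / 2) ^ r ≤ a ^ r + b ^ r := by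
  have h := (convexOn_rpow hr).2 ha hb (by norm_num : (0:ℝ) ≤ 2⁻¹) (by norm_num : (0:ℝ) ≤ 2⁻¹)
    (by norm_num)
  simp only [smul_eq_mul] at h
  rw [show 2⁻¹ * a + 2⁻¹ * b = (a + b) / 2 by ring] at h
  linarith

lemma le_rpow_midpoint {a b r : ℝ} (ha : 0 ≤ a) (hb : 0 ≤ b) (hr0 : 0 ≤ r) (hr : r ≤ 1) :
    a ^ r + b ^ r ≤ 2 * ((a + b) / 2) ^ r := by
  have h := (Real.concaveOn_rpow hr0 hr).2 ha hb (by norm_num : (0:ℝ) ≤ 2⁻¹)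
    (by norm_num : (0:ℝ) ≤ 2⁻¹) (by norm_num)
  simp only [smul_eq_mul] at h
  rw [show 2⁻¹ * a + 2⁻¹ * b = (a + b) / 2 by ring] at h
  linarith

lemma sq_rpow_half {a : ℝ} (ha : 0 ≤ a) (p : ℝ) : (a ^ 2) ^ (p / 2) = a ^ p := by
  rw [← Real.rpow_natCast, ← Real.rpow_mul ha]
  congr 1
  push_cast; ring

lemma rpow_two_div_rpow {a p : ℝ} (ha : 0 ≤ a) (hp : p ≠ 0) : (a ^ p) ^ (2 / p) = a ^ 2 := by
  rw [← Real.rpow_mul ha, mul_div_cancel₀ _ hp, Real.rpow_two]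

variable {H : Type*} [NormedAddCommGroup H] [InnerProductSpace ℝ H]

lemma norm_add_sq_add_norm_sub_sq (x y : H) :
    (‖x + y‖ ^ 2 + ‖x - y‖ ^ 2) / 2 = ‖x‖ ^ 2 + ‖y‖ ^ 2 := by
  have := parallelogram_law_with_norm ℝ x y
  nlinarith

lemma two_mul_norm_rpow_add_le {p : ℝ} (hp : 2 ≤ p) (x y : H) :
    2 * ‖x‖ ^ p + 2 * ‖y‖ ^ p ≤ ‖x + y‖ ^ p + ‖x - y‖ ^ p := by
  have h1 := rpow_midpoint_le (sq_nonneg ‖x + y‖) (sq_nonneg ‖x - y‖) (r := p / 2) (by linarith)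
  have h2 := Real.add_rpow_le_rpow_add (sq_nonneg ‖x‖) (sq_nonneg ‖y‖) (p := p / 2) (by linarith)
  rw [norm_add_sq_add_norm_sub_sq] at h1
  simp only [sq_rpow_half, norm_nonneg] at h1 h2
  linarith

lemma norm_rpow_add_le_two_mul {p : ℝ} (hp0 : 0 ≤ p) (hp : p ≤ 2) (x y : H) :
    ‖x + y‖ ^ p + ‖x - y‖ ^ p ≤ 2 * ‖x‖ ^ p + 2 * ‖y‖ ^ p := by
  have h1 := le_rpow_midpoint (sq_nonneg ‖x + y‖) (sq_nonneg ‖x - y‖) (r := p / 2) (by linarith)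
    (by linarith)
  have h2 := Real.rpow_add_le_add_rpow (sq_nonneg ‖x‖) (sq_nonneg ‖y‖) (p := p / 2) (by linarith)
    (by linarith)
  rw [norm_add_sq_add_norm_sub_sq] at h1
  simp only [sq_rpow_half, norm_nonneg] at h1 h2
  linarith

/-- A Taylor bound $(\sigma+\tau)^m \le \sigma^m + m\sigma^{m-1}\tau + 3^m\sigma^{m-2}\tau^2$,
multiplied by $\sigma^2$ to avoid negative powers. -/
lemma sq_mul_add_pow_le {σ τ : ℝ} (h : |τ| ≤ σ) (m : ℕ) :
    σ ^ 2 * (σ + τ) ^ m ≤ σ ^ m * (σ ^ 2 + m * (σ * τ) + 3 ^ m * τ ^ 2) := by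
  have hσ : 0 ≤ σ := (abs_nonneg τ).trans h
  obtain ⟨h1, h2⟩ := abs_le.1 h
  induction m with
  | zero => simp; positivity
  | succ m ih =>
    have hm : (m : ℝ) ≤ 3 ^ m := by exact_mod_cast (Nat.lt_pow_self (by norm_num)).le
    have h3 : 0 ≤ 3 ^ m * ((σ - τ) * τ ^ 2) := by
      have : 0 ≤ σ - τ := by linarith
      positivity
    have h4 : 0 ≤ (3 ^ m - (m : ℝ)) * (σ * τ ^ 2) :=
      mul_nonneg (by linarith) (by positivity)
    calc σ ^ 2 * (σ + τ) ^ (m + 1) = σ ^ 2 * (σ + τ) ^ m * (σ + τ) := by ring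
      _ ≤ σ ^ m * (σ ^ 2 + m * (σ * τ) + 3 ^ m * τ ^ 2) * (σ + τ) :=
          mul_le_mul_of_nonneg_right ih (by linarith)
      _ = σ ^ m * ((σ ^ 2 + m * (σ * τ) + 3 ^ m * τ ^ 2) * (σ + τ)) := by ring
      _ ≤ σ ^ m * (σ * (σ ^ 2 + ((m + 1 : ℕ) : ℝ) * (σ * τ) + 3 ^ (m + 1) * τ ^ 2)) := by
          refine mul_le_mul_of_nonneg_left ?_ (by positivity)
          push_cast
          rw [pow_succ 3 m]
          linarith
      _ = _ := by ring

/-- With $\sigma = \|x\|^2+\|y\|^2$ and $\tau = 2\langle x,y\rangle$, the two squared norms are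
$\sigma\pm\tau$. The linear terms cancel in the sum, and $\tau^2 \le 4\sigma\|y\|^2$ lets the
quadratic term be absorbed in the coefficient of $\|y\|^2$. -/
lemma norm_sq_pow_add_le {m : ℕ} (hm : 1 ≤ m) (x y : H) :
    (‖x + y‖ ^ 2) ^ m + (‖x - y‖ ^ 2) ^ m ≤
      2 * (‖x‖ ^ 2 + (1 + 4 * 3 ^ m) * ‖y‖ ^ 2) ^ m := by
  set σ := ‖x‖ ^ 2 + ‖y‖ ^ 2 with hσ
  set τ := 2 * inner ℝ x y with hτ
  have e1 : ‖x + y‖ ^ 2 = σ + τ := by rw [norm_add_sq_real]; ring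
  have e2 : ‖x - y‖ ^ 2 = σ + -τ := by rw [norm_sub_sq_real]; ring
  have hin := abs_real_inner_le_norm x y
  have hτ1 : |τ| ≤ 2 * (‖x‖ * ‖y‖) := by
    rw [hτ, abs_mul, abs_two]; linarith
  have hτσ : |τ| ≤ σ := hτ1.trans (by nlinarith [sq_nonneg (‖x‖ - ‖y‖)])
  have hσ0 : 0 ≤ σ := by positivity
  have hτ2 : τ ^ 2 ≤ 4 * (σ * ‖y‖ ^ 2) := by
    calc τ ^ 2 = |τ| ^ 2 := (sq_abs τ).symm
      _ ≤ (2 * (‖x‖ * ‖y‖)) ^ 2 := by gcongr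
      _ ≤ _ := by rw [hσ]; nlinarith [sq_nonneg (‖y‖ ^ 2)]
  have h1 := sq_mul_add_pow_le hτσ m
  have h2 := sq_mul_add_pow_le (σ := σ) (τ := -τ) (by rwa [abs_neg]) m
  rw [e1, e2]
  rcases hσ0.eq_or_lt with h0 | hpos
  · have hτ0 : τ = 0 := abs_nonpos_iff.1 (h0 ▸ hτσ)
    rw [hτ0, ← h0]
    simp only [neg_zero, add_zero, zero_pow (by omega : m ≠ 0)]
    positivity
  have hK : σ + 4 * 3 ^ m * ‖y‖ ^ 2 = ‖x‖ ^ 2 + (1 + 4 * 3 ^ m) * ‖y‖ ^ 2 := by rw [hσ]; ring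
  obtain ⟨k, rfl⟩ := Nat.exists_eq_add_of_le' hm
  have h3 : σ ^ 2 * ((σ + τ) ^ (k + 1) + (σ + -τ) ^ (k + 1)) ≤
      σ ^ 2 * (2 * (σ ^ k * (σ + 4 * 3 ^ (k + 1) * ‖y‖ ^ 2))) := by
    calc _ ≤ σ ^ (k + 1) * (2 * σ ^ 2 + 2 * 3 ^ (k + 1) * τ ^ 2) := by linarith
      _ ≤ σ ^ (k + 1) * (2 * σ ^ 2 + 2 * 3 ^ (k + 1) * (4 * (σ * ‖y‖ ^ 2))) := by gcongr
      _ = _ := by ring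
  refine (le_of_mul_le_mul_left h3 (pow_pos hpos 2)).trans ?_
  rw [← hK, pow_succ (σ + 4 * 3 ^ (k + 1) * ‖y‖ ^ 2)]
  gcongr
  exact le_add_of_nonneg_right (by positivity : 0 ≤ 4 * 3 ^ (k + 1) * ‖y‖ ^ 2)

/-- The constant of 2-uniform smoothness. -/
noncomputable def smoothConst (p : ℝ) : ℝ := 1 + 4 * 3 ^ ⌈p / 2⌉₊

lemma one_le_smoothConst (p : ℝ) : 1 ≤ smoothConst p := by
  rw [smoothConst]
  linarith [show (0:ℝ) ≤ 4 * 3 ^ ⌈p / 2⌉₊ by positivity]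

/-- The integer case $m = \lceil p/2\rceil$ passes to $p/2 \le m$ by concavity of $t \mapsto
t^{p/(2m)}$. -/
lemma norm_rpow_add_le_sq_add {p : ℝ} (hp : 2 ≤ p) (x y : H) :
    ‖x + y‖ ^ p + ‖x - y‖ ^ p ≤ 2 * (‖x‖ ^ 2 + smoothConst p * ‖y‖ ^ 2) ^ (p / 2) := by
  set m := ⌈p / 2⌉₊ with hm
  have hpm : p / 2 ≤ m := Nat.le_ceil _
  have hm0 : (0:ℝ) < m := by linarith
  have hm1 : 1 ≤ m := by exact_mod_cast hm0
  have hS : 0 ≤ ‖x‖ ^ 2 + smoothConst p * ‖y‖ ^ 2 := by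
    have := one_le_smoothConst p
    positivity
  have key : ∀ a : ℝ, 0 ≤ a → (a ^ m) ^ (p / 2 / m) = a ^ (p / 2) := fun a ha => by
    rw [← Real.rpow_natCast, ← Real.rpow_mul ha]
    congr 1
    field_simp
  have h1 := le_rpow_midpoint (a := (‖x + y‖ ^ 2) ^ m) (b := (‖x - y‖ ^ 2) ^ m)
    (r := p / 2 / m) (by positivity) (by positivity) (by positivity)
    (by rw [div_le_one hm0]; exact hpm)
  rw [key _ (by positivity), key _ (by positivity), sq_rpow_half (norm_nonneg _),
    sq_rpow_half (norm_nonneg _)] at h1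
  refine h1.trans ?_
  rw [← key _ hS]
  gcongr
  have := norm_sq_pow_add_le hm1 x y
  rw [smoothConst]
  linarith

/-- Dual to the smoothness inequality for $q \ge 2$: the pair $(x+y, x-y)$ is tested against $(x+cy,
x-cy)$. With $c$ the inverse smoothness constant, the pairing equals $2G$, and smoothness bounds the
$\ell^q$ norm of the test pair by $(2G^{q/2})^{1/q}$. -/
lemma two_mul_sq_add_rpow_le {p q : ℝ} (hpq : p.HolderConjugate q) (hp : p ≤ 2) (x y : H) :
    2 * (‖x‖ ^ 2 + (smoothConst q)⁻¹ * ‖y‖ ^ 2) ^ (p / 2) ≤ ‖x + y‖ ^ p + ‖x - y‖ ^ p := by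
  have hq : 2 ≤ q := by
    have h1 := hpq.inv_add_inv_eq_one
    have h2 : (2:ℝ)⁻¹ ≤ p⁻¹ := inv_anti₀ hpq.pos hp
    have h3 : q⁻¹ ≤ 2⁻¹ := by linarith
    exact (inv_le_inv₀ hpq.symm.pos (by norm_num)).1 h3
  have hp0 := hpq.pos
  have hq0 := hpq.symm.pos
  set c := (smoothConst q)⁻¹ with hc
  have hC0 : 0 < smoothConst q := zero_lt_one.trans_le (one_le_smoothConst q)
  have hc0 : 0 < c := inv_pos.2 hC0
  set G := ‖x‖ ^ 2 + c * ‖y‖ ^ 2 with hG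
  have hG0 : 0 ≤ G := by positivity
  rcases hG0.eq_or_lt with h0 | hGpos
  · rw [← h0, Real.zero_rpow (div_pos hp0 two_pos).ne', mul_zero]; positivity
  have hsm := norm_rpow_add_le_sq_add hq x (c • y)
  have e : ‖x‖ ^ 2 + smoothConst q * ‖c • y‖ ^ 2 = G := by
    rw [norm_smul, Real.norm_of_nonneg hc0.le, mul_pow, hG, hc]
    field_simp
  rw [e] at hsm
  have hinner : 2 * G ≤ ‖x + y‖ * ‖x + c • y‖ + ‖x - y‖ * ‖x - c • y‖ := by
    have h1 := real_inner_le_norm (x + y) (x + c • y)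
    have h2 := real_inner_le_norm (x - y) (x - c • y)
    simp only [inner_add_left, inner_add_right, inner_sub_left, inner_sub_right, inner_smul_right,
      real_inner_self_eq_norm_sq] at h1 h2
    rw [hG]
    linarith
  have hH := Real.inner_le_Lp_mul_Lq_of_nonneg Finset.univ (f := ![‖x + y‖, ‖x - y‖])
    (g := ![‖x + c • y‖, ‖x - c • y‖]) hpq (by simp [Fin.forall_fin_two])
    (by simp [Fin.forall_fin_two])
  simp only [Fin.sum_univ_two, Matrix.cons_val_zero, Matrix.cons_val_one] at hH
  set X := ‖x + y‖ ^ p + ‖x - y‖ ^ p with hX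
  have hX0 : 0 ≤ X := by positivity
  have h2G : 2 * G ≤ X ^ (1 / p) * (2 ^ (1 / q) * G ^ ((2:ℝ)⁻¹)) := by
    refine hinner.trans (hH.trans ?_)
    gcongr
    calc _ ≤ (2 * G ^ (q / 2)) ^ (1 / q) := by gcongr
      _ = _ := by
        rw [Real.mul_rpow (by norm_num) (by positivity), ← Real.rpow_mul hG0]
        congr 2
        field_simp
  have hsplit : 2 * G = (2 ^ (1 / p) * G ^ ((2:ℝ)⁻¹)) * (2 ^ (1 / q) * G ^ ((2:ℝ)⁻¹)) := by
    have e1 : (2:ℝ) ^ (1 / p) * 2 ^ (1 / q) = 2 := by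
      rw [← Real.rpow_add (by norm_num), one_div, one_div, hpq.inv_add_inv_eq_one, Real.rpow_one]
    have e2 : G ^ ((2:ℝ)⁻¹) * G ^ ((2:ℝ)⁻¹) = G := by
      rw [← Real.rpow_add hGpos]; norm_num
    calc 2 * G = (2 ^ (1 / p) * 2 ^ (1 / q)) * (G ^ ((2:ℝ)⁻¹) * G ^ ((2:ℝ)⁻¹)) := by rw [e1, e2]
      _ = _ := by ring
  rw [hsplit] at h2G
  have h3 : 2 ^ (1 / p) * G ^ ((2:ℝ)⁻¹) ≤ X ^ (1 / p) := le_of_mul_le_mul_right h2G (by positivity)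
  have h4 := Real.rpow_le_rpow (by positivity) h3 hp0.le
  rw [Real.mul_rpow (by positivity) (by positivity), ← Real.rpow_mul (by norm_num),
    ← Real.rpow_mul hG0, ← Real.rpow_mul hX0, one_div_mul_cancel hp0.ne', Real.rpow_one,
    Real.rpow_one] at h4
  rwa [inv_mul_eq_div] at h4

lemma div_sq_rpow_half {u α : ℝ} (hu : 0 ≤ u) (hα : 0 < α) (p : ℝ) :
    (u ^ 2 / α ^ 2) ^ (p / 2) = u ^ p / α ^ p := by
  rw [← div_pow, sq_rpow_half (by positivity), Real.div_rpow hu hα.le]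

/-- Jensen's inequality with weights chosen so that equality holds at $(u,v) = (\alpha,\beta)$. For
$\alpha = \|f\|_p$, $\beta = \|g\|_p$ the right side integrates to $(\alpha^2+C\beta^2)^{p/2}$,
which replaces Minkowski's inequality in $L^{p/2}$. -/
lemma sq_add_rpow_le {p C u v α β : ℝ} (hp : 2 ≤ p) (hC : 0 < C) (hu : 0 ≤ u) (hv : 0 ≤ v)
    (hα : 0 < α) (hβ : 0 < β) :
    (u ^ 2 + C * v ^ 2) ^ (p / 2) ≤ (α ^ 2 + C * β ^ 2) ^ (p / 2) *
      (α ^ 2 / (α ^ 2 + C * β ^ 2) * (u ^ p / α ^ p) +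
        C * β ^ 2 / (α ^ 2 + C * β ^ 2) * (v ^ p / β ^ p)) := by
  set S := α ^ 2 + C * β ^ 2 with hS
  have hS0 : 0 < S := by positivity
  have h := (convexOn_rpow (p := p / 2) (by linarith)).2
    (Set.mem_Ici.2 (by positivity : 0 ≤ u ^ 2 / α ^ 2))
    (Set.mem_Ici.2 (by positivity : 0 ≤ v ^ 2 / β ^ 2))
    (by positivity : 0 ≤ α ^ 2 / S) (by positivity : 0 ≤ C * β ^ 2 / S)
    (by rw [← add_div, ← hS, div_self hS0.ne'])
  simp only [smul_eq_mul, div_sq_rpow_half hu hα, div_sq_rpow_half hv hβ] at h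
  calc (u ^ 2 + C * v ^ 2) ^ (p / 2)
      = S ^ (p / 2) *
          (α ^ 2 / S * (u ^ 2 / α ^ 2) + C * β ^ 2 / S * (v ^ 2 / β ^ 2)) ^ (p / 2) := by
        rw [← Real.mul_rpow (by positivity) (by positivity)]
        congr 1
        field_simp
    _ ≤ _ := by gcongr

lemma le_sq_add_rpow {p c u v α β : ℝ} (hp0 : 0 ≤ p) (hp : p ≤ 2) (hc : 0 < c) (hu : 0 ≤ u)
    (hv : 0 ≤ v) (hα : 0 < α) (hβ : 0 < β) :
    (α ^ 2 + c * β ^ 2) ^ (p / 2) *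
      (α ^ 2 / (α ^ 2 + c * β ^ 2) * (u ^ p / α ^ p) +
        c * β ^ 2 / (α ^ 2 + c * β ^ 2) * (v ^ p / β ^ p)) ≤ (u ^ 2 + c * v ^ 2) ^ (p / 2) := by
  set S := α ^ 2 + c * β ^ 2 with hS
  have hS0 : 0 < S := by positivity
  have h := (Real.concaveOn_rpow (p := p / 2) (by linarith) (by linarith)).2
    (Set.mem_Ici.2 (by positivity : 0 ≤ u ^ 2 / α ^ 2))
    (Set.mem_Ici.2 (by positivity : 0 ≤ v ^ 2 / β ^ 2))
    (by positivity : 0 ≤ α ^ 2 / S) (by positivity : 0 ≤ c * β ^ 2 / S)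
    (by rw [← add_div, ← hS, div_self hS0.ne'])
  simp only [smul_eq_mul, div_sq_rpow_half hu hα, div_sq_rpow_half hv hβ] at h
  calc _ ≤ S ^ (p / 2) *
        (α ^ 2 / S * (u ^ 2 / α ^ 2) + c * β ^ 2 / S * (v ^ 2 / β ^ 2)) ^ (p / 2) := by gcongr
    _ = (u ^ 2 + c * v ^ 2) ^ (p / 2) := by
        rw [← Real.mul_rpow (by positivity) (by positivity)]
        congr 1
        field_simp

end TwoPoint

end MartApprox

/-! ### Smoothness and convexity of $L^p(H)$ -/

namespace MartApprox

section LpGeometry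

variable {Ω : Type*} {mΩ : MeasurableSpace Ω} {P : Measure Ω} {H : Type*} [NormedAddCommGroup H]

lemma Lp_integrable_norm_rpow {p : ℝ} (hp : 0 < p) (f : Lp H (ENNReal.ofReal p) P) :
    Integrable (fun ω => ‖f ω‖ ^ p) P := by
  have h := (Lp.memLp f).integrable_norm_rpow (by simpa using hp) ENNReal.ofReal_ne_top
  rwa [ENNReal.toReal_ofReal hp.le] at h

lemma Lp_norm_rpow_eq_integral {p : ℝ} (hp : 0 < p) (f : Lp H (ENNReal.ofReal p) P) :
    ‖f‖ ^ p = ∫ ω, ‖f ω‖ ^ p ∂P := by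
  rw [Lp.norm_def, toReal_eLpNorm (Lp.aestronglyMeasurable f),
    lpNorm_eq_integral_norm_rpow_toReal (by simpa using hp) ENNReal.ofReal_ne_top
      (Lp.aestronglyMeasurable f), ENNReal.toReal_ofReal hp.le,
    ← Real.rpow_mul (integral_nonneg fun _ => by positivity), inv_mul_cancel₀ hp.ne', Real.rpow_one]

lemma Lp_norm_add_rpow_add {p : ℝ} (hp : 0 < p) (f g : Lp H (ENNReal.ofReal p) P) :
    ‖f + g‖ ^ p + ‖f - g‖ ^ p = ∫ ω, (‖f ω + g ω‖ ^ p + ‖f ω - g ω‖ ^ p) ∂P := by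
  rw [Lp_norm_rpow_eq_integral hp, Lp_norm_rpow_eq_integral hp,
    ← integral_add (Lp_integrable_norm_rpow hp _) (Lp_integrable_norm_rpow hp _)]
  refine integral_congr_ae ?_
  filter_upwards [Lp.coeFn_add f g, Lp.coeFn_sub f g] with ω h1 h2
  rw [h1, h2]
  rfl

lemma Lp_integrable_norm_add_rpow_add {p : ℝ} (hp : 0 < p) (f g : Lp H (ENNReal.ofReal p) P) :
    Integrable (fun ω => ‖f ω + g ω‖ ^ p + ‖f ω - g ω‖ ^ p) P := by
  refine ((Lp_integrable_norm_rpow hp (f + g)).add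
    (Lp_integrable_norm_rpow hp (f - g))).congr ?_
  filter_upwards [Lp.coeFn_add f g, Lp.coeFn_sub f g] with ω h1 h2
  simp only [Pi.add_apply, h1, h2, Pi.sub_apply]

/-- The linear combination of `‖f‖ ^ p` and `‖g‖ ^ p` that appears when linearizing Minkowski's
inequality integrates to one. -/
lemma integral_weighted_rpow {p a b : ℝ} (hp : 0 < p) (hab : a + b = 1)
    {f g : Lp H (ENNReal.ofReal p) P} (hf : 0 < ‖f‖) (hg : 0 < ‖g‖) (S : ℝ) :
    Integrable (fun ω => S * (a * (‖f ω‖ ^ p / ‖f‖ ^ p) + b * (‖g ω‖ ^ p / ‖g‖ ^ p))) P ∧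
      ∫ ω, S * (a * (‖f ω‖ ^ p / ‖f‖ ^ p) + b * (‖g ω‖ ^ p / ‖g‖ ^ p)) ∂P = S := by
  have h1 := ((Lp_integrable_norm_rpow hp f).div_const (‖f‖ ^ p)).const_mul a
  have h2 := ((Lp_integrable_norm_rpow hp g).div_const (‖g‖ ^ p)).const_mul b
  refine ⟨(h1.add h2).const_mul S, ?_⟩
  rw [integral_const_mul, integral_add h1 h2, integral_const_mul, integral_const_mul, integral_div,
    integral_div, ← Lp_norm_rpow_eq_integral hp, ← Lp_norm_rpow_eq_integral hp,
    div_self (by positivity), div_self (by positivity), mul_one, mul_one, hab, mul_one]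

variable [InnerProductSpace ℝ H]

lemma Lp_norm_rpow_le_of_le_two {p : ℝ} (hp0 : 0 < p) (hp : p ≤ 2)
    (f g : Lp H (ENNReal.ofReal p) P) :
    ‖f + g‖ ^ p + ‖f - g‖ ^ p ≤ 2 * ‖f‖ ^ p + 2 * ‖g‖ ^ p := by
  have hf := (Lp_integrable_norm_rpow hp0 f).const_mul 2
  have hg := (Lp_integrable_norm_rpow hp0 g).const_mul 2
  rw [Lp_norm_add_rpow_add hp0, Lp_norm_rpow_eq_integral hp0 f, Lp_norm_rpow_eq_integral hp0 g,
    ← integral_const_mul, ← integral_const_mul, ← integral_add hf hg]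
  exact integral_mono (Lp_integrable_norm_add_rpow_add hp0 f g) (hf.add hg)
    fun ω => norm_rpow_add_le_two_mul hp0.le hp _ _

lemma Lp_le_norm_rpow_of_two_le {p : ℝ} (hp : 2 ≤ p) (f g : Lp H (ENNReal.ofReal p) P) :
    2 * ‖f‖ ^ p + 2 * ‖g‖ ^ p ≤ ‖f + g‖ ^ p + ‖f - g‖ ^ p := by
  have hp0 : 0 < p := by linarith
  have hf := (Lp_integrable_norm_rpow hp0 f).const_mul 2
  have hg := (Lp_integrable_norm_rpow hp0 g).const_mul 2
  rw [Lp_norm_add_rpow_add hp0, Lp_norm_rpow_eq_integral hp0 f, Lp_norm_rpow_eq_integral hp0 g,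
    ← integral_const_mul, ← integral_const_mul, ← integral_add hf hg]
  exact integral_mono (hf.add hg) (Lp_integrable_norm_add_rpow_add hp0 f g)
    fun ω => two_mul_norm_rpow_add_le hp _ _

lemma sq_weights_add {C α β : ℝ} (hC : 0 < C) (hα : 0 < α) :
    α ^ 2 / (α ^ 2 + C * β ^ 2) + C * β ^ 2 / (α ^ 2 + C * β ^ 2) = 1 := by
  rw [← add_div, div_self (by positivity)]

/-- The linearized pointwise inequality is integrated, and concavity of $t \mapsto t^{2/p}$ converts
the sum of $p$-th powers into a sum of squares. Null functions are treated apart, because the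
weights divide by the norms. -/
lemma Lp_norm_sq_le_of_two_le {p : ℝ} (hp : 2 ≤ p) [Fact (1 ≤ ENNReal.ofReal p)]
    (f g : Lp H (ENNReal.ofReal p) P) :
    ‖f + g‖ ^ 2 + ‖f - g‖ ^ 2 ≤ 2 * ‖f‖ ^ 2 + 2 * smoothConst p * ‖g‖ ^ 2 := by
  have hp0 : 0 < p := by linarith
  have hC1 := one_le_smoothConst p
  have hC : 0 < smoothConst p := by linarith
  rcases (norm_nonneg f).eq_or_lt with hf | hf
  · have hf0 : f = 0 := norm_eq_zero.1 hf.symm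
    subst hf0
    simp only [zero_add, zero_sub, norm_neg, norm_zero]
    nlinarith [sq_nonneg ‖g‖]
  rcases (norm_nonneg g).eq_or_lt with hg | hg
  · have hg0 : g = 0 := norm_eq_zero.1 hg.symm
    subst hg0
    simp only [add_zero, sub_zero, norm_zero]
    linarith
  set S := ‖f‖ ^ 2 + smoothConst p * ‖g‖ ^ 2 with hS
  obtain ⟨hi, he⟩ := integral_weighted_rpow hp0 (sq_weights_add (β := ‖g‖) hC hf) hf hg
    (2 * S ^ (p / 2))
  have h1 : ‖f + g‖ ^ p + ‖f - g‖ ^ p ≤ 2 * S ^ (p / 2) := by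
    rw [Lp_norm_add_rpow_add hp0, ← he]
    refine integral_mono (Lp_integrable_norm_add_rpow_add hp0 f g) hi fun ω => ?_
    refine (norm_rpow_add_le_sq_add hp (f ω) (g ω)).trans ?_
    have := sq_add_rpow_le hp hC (norm_nonneg (f ω)) (norm_nonneg (g ω)) hf hg
    simp only [mul_assoc]
    linarith
  have hS0 : 0 ≤ S := by positivity
  have h2 := le_rpow_midpoint (a := ‖f + g‖ ^ p) (b := ‖f - g‖ ^ p) (r := 2 / p)
    (by positivity) (by positivity) (by positivity) (by rw [div_le_one hp0]; exact hp)
  rw [rpow_two_div_rpow (norm_nonneg _) hp0.ne', rpow_two_div_rpow (norm_nonneg _) hp0.ne'] at h2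
  have h3 : ((‖f + g‖ ^ p + ‖f - g‖ ^ p) / 2) ^ (2 / p) ≤ S := by
    calc _ ≤ (S ^ (p / 2)) ^ (2 / p) := by
          gcongr
          linarith
      _ = S := by
          rw [← Real.rpow_mul hS0, show p / 2 * (2 / p) = 1 by field_simp, Real.rpow_one]
  linarith

lemma Lp_le_norm_sq_of_le_two {p q : ℝ} (hpq : p.HolderConjugate q) (hp : p ≤ 2)
    [Fact (1 ≤ ENNReal.ofReal p)] (f g : Lp H (ENNReal.ofReal p) P) :
    2 * ‖f‖ ^ 2 + 2 * (smoothConst q)⁻¹ * ‖g‖ ^ 2 ≤ ‖f + g‖ ^ 2 + ‖f - g‖ ^ 2 := by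
  have hp0 : 0 < p := hpq.pos
  have hc1 : (smoothConst q)⁻¹ ≤ 1 := inv_le_one_of_one_le₀ (one_le_smoothConst q)
  have hc : 0 < (smoothConst q)⁻¹ := inv_pos.2 (zero_lt_one.trans_le (one_le_smoothConst q))
  rcases (norm_nonneg f).eq_or_lt with hf | hf
  · have hf0 : f = 0 := norm_eq_zero.1 hf.symm
    subst hf0
    simp only [zero_add, zero_sub, norm_neg, norm_zero]
    nlinarith [sq_nonneg ‖g‖]
  rcases (norm_nonneg g).eq_or_lt with hg | hg
  · have hg0 : g = 0 := norm_eq_zero.1 hg.symm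
    subst hg0
    simp only [add_zero, sub_zero, norm_zero]
    linarith
  set S := ‖f‖ ^ 2 + (smoothConst q)⁻¹ * ‖g‖ ^ 2 with hS
  obtain ⟨hi, he⟩ := integral_weighted_rpow hp0 (sq_weights_add (β := ‖g‖) hc hf) hf hg
    (2 * S ^ (p / 2))
  have h1 : 2 * S ^ (p / 2) ≤ ‖f + g‖ ^ p + ‖f - g‖ ^ p := by
    rw [Lp_norm_add_rpow_add hp0, ← he]
    refine integral_mono hi (Lp_integrable_norm_add_rpow_add hp0 f g) fun ω => ?_
    refine le_trans ?_ (two_mul_sq_add_rpow_le hpq hp (f ω) (g ω))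
    have := le_sq_add_rpow hp0.le hp hc (norm_nonneg (f ω)) (norm_nonneg (g ω)) hf hg
    simp only [mul_assoc] at this ⊢
    linarith
  have hS0 : 0 ≤ S := by positivity
  have h2 := rpow_midpoint_le (a := ‖f + g‖ ^ p) (b := ‖f - g‖ ^ p) (r := 2 / p)
    (by positivity) (by positivity) (by rw [le_div_iff₀ hp0]; linarith)
  rw [rpow_two_div_rpow (norm_nonneg _) hp0.ne', rpow_two_div_rpow (norm_nonneg _) hp0.ne'] at h2
  have h3 : S ≤ ((‖f + g‖ ^ p + ‖f - g‖ ^ p) / 2) ^ (2 / p) := by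
    calc S = (S ^ (p / 2)) ^ (2 / p) := by
          rw [← Real.rpow_mul hS0, show p / 2 * (2 / p) = 1 by field_simp, Real.rpow_one]
      _ ≤ _ := by
          gcongr
          linarith
  linarith

/-- `L^p(H)` is uniformly smooth of power type `min 2 p`. -/
theorem smoothType_Lp {p : ℝ} (hp : 1 < p) [Fact (1 ≤ ENNReal.ofReal p)] :
    SmoothType (Lp H (ENNReal.ofReal p) P) (min 2 p) (2 * smoothConst p) := by
  intro f g
  rcases le_total 2 p with h | h
  · rw [min_eq_left h]
    simpa only [Real.rpow_two] using Lp_norm_sq_le_of_two_le h f g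
  · rw [min_eq_right h]
    refine (Lp_norm_rpow_le_of_le_two (by linarith) h f g).trans ?_
    gcongr
    linarith [one_le_smoothConst p]

/-- `L^p(H)` is uniformly convex of power type `max 2 p`. -/
theorem convexType_Lp {p : ℝ} (hp : 1 < p) [Fact (1 ≤ ENNReal.ofReal p)] :
    ConvexType (Lp H (ENNReal.ofReal p) P) (max 2 p) (2 * (smoothConst p.conjExponent)⁻¹) := by
  intro f g
  rcases le_total 2 p with h | h
  · rw [max_eq_right h]
    refine le_trans ?_ (Lp_le_norm_rpow_of_two_le h f g)
    gcongr
    linarith [inv_le_one_of_one_le₀ (one_le_smoothConst p.conjExponent)]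
  · rw [max_eq_left h]
    simpa only [Real.rpow_two] using Lp_le_norm_sq_of_le_two (.conjExponent hp) h f g

end LpGeometry

end MartApprox

/-! ### Composition and conditional expectation as operators on $L^p$ -/

namespace MartApprox

section Shift

variable {Ω : Type*} {mΩ : MeasurableSpace Ω} {P : Measure Ω}
  {H : Type*} [NormedAddCommGroup H] [NormedSpace ℝ H] {p : ℝ≥0∞} [Fact (1 ≤ p)]

/-- Composition with a measure preserving equivalence, as an isometric equivalence of `L^p`. -/
noncomputable def LpShift (p : ℝ≥0∞) [Fact (1 ≤ p)] (H : Type*) [NormedAddCommGroup H]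
    [NormedSpace ℝ H] {θ : Ω ≃ᵐ Ω} (hθ : MeasurePreserving θ P P) :
    Lp H p P ≃ₗᵢ[ℝ] Lp H p P :=
  LinearIsometryEquiv.ofLinearIsometry (Lp.compMeasurePreservingₗᵢ ℝ θ hθ)
    (Lp.compMeasurePreservingₗᵢ ℝ θ.symm (hθ.symm θ)).toLinearMap
    (by
      ext1 f
      change Lp.compMeasurePreserving θ hθ (Lp.compMeasurePreserving θ.symm (hθ.symm θ) f) = f
      rw [← Lp.compMeasurePreserving_comp_apply]
      simp)
    (by
      ext1 f
      change Lp.compMeasurePreserving θ.symm (hθ.symm θ) (Lp.compMeasurePreserving θ hθ f) = f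
      rw [← Lp.compMeasurePreserving_comp_apply]
      simp)

lemma coeFn_LpShift {θ : Ω ≃ᵐ Ω} (hθ : MeasurePreserving θ P P) (f : Lp H p P) :
    LpShift p H hθ f =ᵐ[P] f ∘ θ :=
  Lp.coeFn_compMeasurePreserving f hθ

lemma coeFn_LpShift_symm {θ : Ω ≃ᵐ Ω} (hθ : MeasurePreserving θ P P) (f : Lp H p P) :
    (LpShift p H hθ).symm f =ᵐ[P] f ∘ θ.symm :=
  Lp.coeFn_compMeasurePreserving f (hθ.symm θ)

end Shift

section Operators

variable {Ω : Type*} {F₀ : MeasurableSpace Ω} {mΩ : MeasurableSpace Ω} {P : Measure Ω}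
  [IsProbabilityMeasure P] {H : Type*} [NormedAddCommGroup H] [NormedSpace ℝ H] [CompleteSpace H]

/-- Conditional expectations commute with measure preserving transformations. -/
lemma condExp_comp_measurableEquiv {θ : Ω ≃ᵐ Ω} (hθ : MeasurePreserving θ P P) (hF : F₀ ≤ mΩ)
    {f : Ω → H} (hf : Integrable f P) :
    P[f ∘ θ | F₀.comap θ] =ᵐ[P] P[f | F₀] ∘ θ := by
  have hm : F₀.comap θ ≤ mΩ :=
    (MeasurableSpace.comap_mono hF).trans (measurable_iff_comap_le.1 θ.measurable)
  have hint : Integrable (P[f | F₀] ∘ θ) P := hθ.integrable_comp_of_integrable integrable_condExp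
  refine (ae_eq_condExp_of_forall_setIntegral_eq hm (hθ.integrable_comp_of_integrable hf)
    (fun s _ _ => hint.integrableOn) ?_ ?_).symm
  · rintro s ⟨t, ht, rfl⟩ -
    have h1 := hθ.setIntegral_preimage_emb θ.measurableEmbedding P[f | F₀] t
    have h2 := hθ.setIntegral_preimage_emb θ.measurableEmbedding f t
    simp only [Function.comp_apply]
    rw [h1, h2, setIntegral_condExp hF hf ht]
  · exact (stronglyMeasurable_condExp.comp_measurable
      (comap_measurable (m := F₀) θ)).aestronglyMeasurable

lemma comap_symm_le {θ : Ω ≃ᵐ Ω} (hF : F₀ ≤ F₀.comap θ) : F₀.comap θ.symm ≤ F₀ := by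
  refine (MeasurableSpace.comap_mono hF).trans ?_
  rw [MeasurableSpace.comap_comp, MeasurableEquiv.self_comp_symm, MeasurableSpace.comap_id]

variable {p : ℝ≥0∞} [hp : Fact (1 ≤ p)]

/-- The conditional expectation as a contraction of `L^p`. -/
noncomputable def LpCondExp (p : ℝ≥0∞) [hp : Fact (1 ≤ p)] (H : Type*) [NormedAddCommGroup H]
    [NormedSpace ℝ H] [CompleteSpace H] (F₀ : MeasurableSpace Ω) {mΩ : MeasurableSpace Ω}
    (P : Measure Ω) [IsProbabilityMeasure P] : Lp H p P →L[ℝ] Lp H p P :=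
  LinearMap.mkContinuous
    { toFun := fun f => ((Lp.memLp f).condExp (m := F₀) hp.out).toLp _
      map_add' := fun f g => by
        rw [← MemLp.toLp_add]
        refine MemLp.toLp_congr _ _ ?_
        exact (condExp_congr_ae (Lp.coeFn_add f g)).trans
          (condExp_add ((Lp.memLp f).integrable hp.out) ((Lp.memLp g).integrable hp.out) F₀)
      map_smul' := fun c f => by
        rw [RingHom.id_apply, ← MemLp.toLp_const_smul]
        refine MemLp.toLp_congr _ _ ?_
        exact (condExp_congr_ae (Lp.coeFn_smul c f)).trans (condExp_smul c f F₀) }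
    1 (fun f => by
      rw [one_mul, Lp.norm_def f]
      change ‖((Lp.memLp f).condExp (m := F₀) hp.out).toLp _‖ ≤ _
      rw [Lp.norm_toLp]
      exact ENNReal.toReal_mono (Lp.eLpNorm_ne_top f) (eLpNorm_condExp_le_eLpNorm _ hp.out))

lemma coeFn_LpCondExp (f : Lp H p P) : LpCondExp p H F₀ P f =ᵐ[P] P[f | F₀] :=
  MemLp.coeFn_toLp ((Lp.memLp f).condExp (m := F₀) hp.out)

lemma norm_LpCondExp_le (f : Lp H p P) : ‖LpCondExp p H F₀ P f‖ ≤ ‖f‖ := by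
  change ‖((Lp.memLp f).condExp (m := F₀) hp.out).toLp _‖ ≤ _
  rw [Lp.norm_toLp, Lp.norm_def f]
  exact ENNReal.toReal_mono (Lp.eLpNorm_ne_top f) (eLpNorm_condExp_le_eLpNorm _ hp.out)

/-- The shift and the conditional expectation on `L^p`. -/
noncomputable def LpAdaptedShift (p : ℝ≥0∞) [hp : Fact (1 ≤ p)] (H : Type*) [NormedAddCommGroup H]
    [NormedSpace ℝ H] [CompleteSpace H] {θ : Ω ≃ᵐ Ω} (hθ : MeasurePreserving θ P P)
    (hF : F₀ ≤ mΩ) (hF₀ : F₀ ≤ F₀.comap θ) : AdaptedShift (Lp H p P) where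
  U := LpShift p H hθ
  Q := LpCondExp p H F₀ P
  norm_Q_le := norm_LpCondExp_le
  Q_Q f := by
    refine Lp.ext ?_
    refine (coeFn_LpCondExp _).trans ((condExp_congr_ae (coeFn_LpCondExp f)).trans ?_)
    exact (condExp_condExp_of_le le_rfl hF).trans (coeFn_LpCondExp f).symm
  Q_U_Q f := by
    have hm : F₀.comap θ ≤ mΩ :=
      (MeasurableSpace.comap_mono hF).trans (measurable_iff_comap_le.1 θ.measurable)
    have hf : Integrable f P := (Lp.memLp f).integrable hp.out
    refine Lp.ext ((coeFn_LpCondExp _).trans (EventuallyEq.trans ?_ (coeFn_LpCondExp _).symm))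
    -- Shifting $\mathbb E_0 f$ gives $\mathbb E_1(f\circ\theta)$; the tower property for $\mathcal
    -- F_0 \subseteq \mathcal F_1$ then concludes.
    have h1 : LpShift p H hθ (LpCondExp p H F₀ P f) =ᵐ[P] P[f ∘ θ | F₀.comap θ] :=
      (coeFn_LpShift hθ _).trans
        ((hθ.quasiMeasurePreserving.ae_eq_comp (coeFn_LpCondExp f)).trans
          (condExp_comp_measurableEquiv hθ hF hf).symm)
    exact (condExp_congr_ae h1).trans ((condExp_condExp_of_le hF₀ hm).trans
      (condExp_congr_ae (coeFn_LpShift hθ f).symm))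
  Q_symm_Q f := by
    have h1 : (LpShift p H hθ).symm (LpCondExp p H F₀ P f) =ᵐ[P] P[f | F₀] ∘ θ.symm :=
      (coeFn_LpShift_symm hθ _).trans
        ((hθ.symm θ).quasiMeasurePreserving.ae_eq_comp (coeFn_LpCondExp f))
    refine Lp.ext ((coeFn_LpCondExp _).trans ((condExp_congr_ae h1).trans
      (EventuallyEq.trans ?_ h1.symm)))
    have hsm : StronglyMeasurable[F₀] (P[f | F₀] ∘ θ.symm) :=
      (stronglyMeasurable_condExp.comp_measurable
        (comap_measurable (m := F₀) θ.symm)).mono (comap_symm_le hF₀)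
    rw [condExp_of_stronglyMeasurable hF hsm
      ((hθ.symm θ).integrable_comp_of_integrable integrable_condExp)]

end Operators

end MartApprox

/-! ### Translation to functions, and the main theorem -/

namespace MartApprox

section Shift

variable {Ω : Type*} {mΩ : MeasurableSpace Ω} {θ : Ω ≃ᵐ Ω}

lemma iter_zero : iter θ 0 = id := by
  simp [iter]

lemma iter_neg_one : iter θ (0 - 1) = θ.symm := by
  rw [zero_sub, iter, zpow_neg_one]
  rfl

lemma iter_succ (k : ℕ) : iter θ ((k + 1 : ℕ) : ℤ) = iter θ (k : ℤ) ∘ θ := by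
  rw [iter, Nat.cast_succ, zpow_add_one]
  rfl

lemma sigmaAlg_zero (F₀ : MeasurableSpace Ω) : sigmaAlg F₀ θ 0 = F₀ := by
  rw [sigmaAlg, iter_zero, MeasurableSpace.comap_id]

lemma partialSum_eq {H : Type*} [AddCommMonoid H] (Y : Ω → H) (n : ℕ) :
    partialSum θ Y n = fun ω => ∑ k ∈ Finset.range n, shift θ Y ((k + 1 : ℕ) : ℤ) ω := by
  funext ω
  rw [partialSum, Finset.range_eq_Ico, Finset.sum_Ico_add' (fun k : ℕ => shift θ Y (k : ℤ) ω) 0 n 1,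
    zero_add]
  rfl

end Shift

section Series

variable {Ω : Type*} {mΩ : MeasurableSpace Ω} {P : Measure Ω} {E : Type*} [NormedAddCommGroup E]
  {p : ℝ} [Fact (1 ≤ ENNReal.ofReal p)]

lemma coeFn_sum_ae_eq {q : ℝ≥0∞} {ι : Type*} (s : Finset ι) {F : ι → Lp E q P} {f : ι → Ω → E}
    (h : ∀ i ∈ s, F i =ᵐ[P] f i) : ⇑(∑ i ∈ s, F i) =ᵐ[P] fun ω => ∑ i ∈ s, f i ω := by
  have hall : ∀ᵐ ω ∂P, ∀ i ∈ s, F i ω = f i ω := (Finset.eventually_all s).2 h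
  filter_upwards [Lp.coeFn_finsetSum s F, hall] with ω h1 h2
  rw [h1, Finset.sum_apply]
  exact Finset.sum_congr rfl h2

lemma LpHasSum.of_tendsto {f : ℕ → Ω → E} {F : ℕ → Lp E (ENNReal.ofReal p) P}
    {G : Lp E (ENNReal.ofReal p) P} (h : ∀ n, F n =ᵐ[P] f n)
    (hG : Tendsto (fun N => ∑ n ∈ Finset.range N, F n) atTop (𝓝 G)) : LpHasSum P p f G := by
  refine ⟨Lp.memLp G, ?_⟩
  refine ((Lp.tendsto_Lp_iff_tendsto_eLpNorm' _ _).1 hG).congr fun N => eLpNorm_congr_ae ?_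
  filter_upwards [coeFn_sum_ae_eq (Finset.range N) fun n _ => h n] with ω hω
  rw [Pi.sub_apply, hω]

lemma exists_LpHasSum_norm {F : ℕ → Lp E (ENNReal.ofReal p) P} (hF : Summable fun n => ‖F n‖) :
    ∃ G : Ω → ℝ, LpHasSum P p (fun n ω => ‖F n ω‖) G := by
  set F' : ℕ → Lp ℝ (ENNReal.ofReal p) P := fun n => (Lp.memLp (F n)).norm.toLp _ with hF'
  have hsum : Summable F' := by
    refine Summable.of_norm (hF.congr fun n => ?_)
    rw [hF', Lp.norm_toLp, eLpNorm_norm, Lp.norm_def]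
  exact ⟨_, LpHasSum.of_tendsto (fun n => MemLp.coeFn_toLp (Lp.memLp (F n)).norm)
    hsum.hasSum.tendsto_sum_nat⟩

end Series

section Transfer

variable {Ω : Type*} {F₀ : MeasurableSpace Ω} {mΩ : MeasurableSpace Ω} {P : Measure Ω}
  [IsProbabilityMeasure P] {H : Type*} [NormedAddCommGroup H] [NormedSpace ℝ H] [CompleteSpace H]
  {p : ℝ≥0∞} [hp : Fact (1 ≤ p)] {θ : Ω ≃ᵐ Ω} (hθ : MeasurePreserving θ P P)
  (hF : F₀ ≤ mΩ) (hF₀ : F₀ ≤ F₀.comap θ) {Y : Ω → H} {f : Lp H p P}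

lemma coeFn_zpow_ae_eq (hf : f =ᵐ[P] Y) (k : ℕ) :
    ((LpAdaptedShift p H hθ hF hF₀).U ^ (k : ℤ)) f =ᵐ[P] shift θ Y (k : ℤ) := by
  induction k with
  | zero =>
    simp only [Nat.cast_zero, zpow_zero, LinearIsometryEquiv.coe_one, id_eq]
    refine hf.trans (Eq.eventuallyEq ?_)
    funext ω
    rw [shift, iter_zero, id]
  | succ k ih =>
    have h : shift θ Y ((k + 1 : ℕ) : ℤ) = shift θ Y (k : ℤ) ∘ θ := by
      funext ω
      rw [shift, iter_succ]
      rfl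
    rw [h, Nat.cast_succ, AdaptedShift.zpow_succ_apply]
    exact (coeFn_LpShift hθ _).trans (hθ.quasiMeasurePreserving.ae_eq_comp ih)

lemma coeFn_S_ae_eq (hf : f =ᵐ[P] Y) (n : ℕ) :
    (LpAdaptedShift p H hθ hF hF₀).S f n =ᵐ[P] partialSum θ Y n := by
  rw [partialSum_eq, AdaptedShift.S]
  exact coeFn_sum_ae_eq _ fun k _ => by simpa using coeFn_zpow_ae_eq hθ hF hF₀ hf (k + 1)

lemma coeFn_Q_ae_eq (hf : f =ᵐ[P] Y) :
    (LpAdaptedShift p H hθ hF hF₀).Q f =ᵐ[P] condE F₀ P θ 0 Y := by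
  rw [condE, sigmaAlg_zero]
  exact (coeFn_LpCondExp f).trans (condExp_congr_ae hf)

/-- Covariance of the conditional expectation under $\theta^{-1}$ identifies $U^{-1}\mathbb E_0 U$
with conditioning on $\mathcal F_{-1}$. -/
lemma coeFn_R_ae_eq (hf : f =ᵐ[P] Y) :
    (LpAdaptedShift p H hθ hF hF₀).R f =ᵐ[P] condE F₀ P θ (0 - 1) Y := by
  rw [condE, sigmaAlg, iter_neg_one, AdaptedShift.R_apply]
  set g := LpShift p H hθ f with hg
  have hgint : Integrable g P := (Lp.memLp g).integrable hp.out
  have h1 : g ∘ θ.symm =ᵐ[P] Y := by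
    refine ((hθ.symm θ).quasiMeasurePreserving.ae_eq_comp (coeFn_LpShift hθ f)).trans ?_
    rw [Function.comp_assoc, MeasurableEquiv.self_comp_symm, Function.comp_id]
    exact hf
  refine (coeFn_LpShift_symm hθ _).trans ?_
  refine ((hθ.symm θ).quasiMeasurePreserving.ae_eq_comp (coeFn_LpCondExp g)).trans ?_
  exact (condExp_comp_measurableEquiv (hθ.symm θ) hF hgint).symm.trans (condExp_congr_ae h1)

lemma coeFn_innov_ae_eq (hf : f =ᵐ[P] Y) :
    (LpAdaptedShift p H hθ hF hF₀).innov f =ᵐ[P] proj F₀ P θ 0 Y := by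
  rw [AdaptedShift.innov_apply]
  filter_upwards [Lp.coeFn_sub ((LpAdaptedShift p H hθ hF hF₀).Q f)
    ((LpAdaptedShift p H hθ hF hF₀).R f), coeFn_Q_ae_eq hθ hF hF₀ hf,
    coeFn_R_ae_eq hθ hF hF₀ hf] with ω h1 h2 h3
  rw [h1, Pi.sub_apply, h2, h3, proj]

lemma projNorm_eq (hf : f =ᵐ[P] Y) (l : ℕ) :
    (LpAdaptedShift p H hθ hF hF₀).projNorm f l =
      eLpNorm (condE F₀ P θ 0 (partialSum θ Y l)) p P := by
  rw [AdaptedShift.projNorm, Lp.enorm_def]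
  exact eLpNorm_congr_ae (coeFn_Q_ae_eq hθ hF hF₀ (coeFn_S_ae_eq hθ hF hF₀ hf l))

end Transfer

lemma natCast_floor_rpow_le {a b : ℝ} (ha : 0 < a) (hb : 0 < b) (n : ℕ) :
    ((⌊(n : ℝ) ^ (b / a)⌋₊ : ℕ) : ℝ≥0∞) ^ (1 / b) ≤ (n : ℝ≥0∞) ^ (1 / a) := by
  have h1 : ((⌊(n : ℝ) ^ (b / a)⌋₊ : ℕ) : ℝ≥0∞) ≤ (n : ℝ≥0∞) ^ (b / a) := by
    rw [← ENNReal.ofReal_natCast, ← ENNReal.ofReal_natCast n,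
      ENNReal.ofReal_rpow_of_nonneg (Nat.cast_nonneg n) (by positivity)]
    exact ENNReal.ofReal_le_ofReal (Nat.floor_le (by positivity))
  calc _ ≤ ((n : ℝ≥0∞) ^ (b / a)) ^ (1 / b) := by gcongr
    _ = _ := by
      rw [← ENNReal.rpow_mul]
      congr 1
      field_simp

end MartApprox

theorem mainTheorem1 (p : ℝ) (hp : 1 < p) :
    ∃ C : ℝ≥0,
      ∀ (Ω : Type u) (F₀ : MeasurableSpace Ω) [mΩ : MeasurableSpace Ω]
        (P : Measure Ω) [IsProbabilityMeasure P]
        (H : Type v) [NormedAddCommGroup H] [InnerProductSpace ℝ H] [CompleteSpace H]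
        [TopologicalSpace.SeparableSpace H]
        (θ : Ω ≃ᵐ Ω) (_ : MeasurePreserving θ P P)
        (_ : F₀ ≤ mΩ) (_ : F₀ ≤ F₀.comap θ)
        (X₀ : Ω → H) (_ : StronglyMeasurable[F₀] X₀) (_ : MemLp X₀ (ENNReal.ofReal p) P)
        (_ : ∫ ω, X₀ ω ∂P = 0)
        (_ : MartApprox.mwTail F₀ P θ X₀ p 1 < ∞),
        ∃ (T : ℕ → Ω → H) (G : Ω → ℝ) (D : Ω → H),
          -- `T n = ∑_{k ≥ n} P_0(X_k) / (k + 1)` in `L^p(H)`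
          (∀ n : ℕ, MartApprox.LpHasSum P p
            (fun j ω => ((n + j : ℕ) + 1 : ℝ)⁻¹ •
              MartApprox.proj F₀ P θ 0 (MartApprox.shift θ X₀ ((n + j : ℕ) : ℤ)) ω) (T n)) ∧
          -- `∑_{n ≥ 0} |T n|_H` converges in `L^p`
          MartApprox.LpHasSum P p (fun n ω => ‖T n ω‖) G ∧
          -- `D = ∑_{n ≥ 0} T n` in `L^p(H)`
          MartApprox.LpHasSum P p T D ∧
          ∀ n : ℕ, 1 ≤ n →
            eLpNorm (fun ω => MartApprox.partialSum θ X₀ n ω - MartApprox.partialSum θ D n ω)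
                (ENNReal.ofReal p) P ≤
              C * (n : ℝ≥0∞) ^ (1 / min 2 p) *
                MartApprox.mwTail F₀ P θ X₀ p ⌊(n : ℝ) ^ (max 2 p / min 2 p)⌋₊ := by
  have hFact : Fact (1 ≤ ENNReal.ofReal p) := ⟨by simpa using ENNReal.ofReal_le_ofReal hp.le⟩
  set s := max 2 p with hs
  set s' := min 2 p with hs'
  set c := 2 * (MartApprox.smoothConst p.conjExponent)⁻¹ with hc
  set C := 2 * MartApprox.smoothConst p with hC
  have hs2 : 2 ≤ s := le_max_left _ _
  have hs'0 : 0 < s' := lt_min two_pos (by linarith)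
  have hc0 : 0 < c :=
    mul_pos two_pos (inv_pos.2 (zero_lt_one.trans_le (MartApprox.one_le_smoothConst _)))
  have hC0 : 0 ≤ C := by linarith [MartApprox.one_le_smoothConst p]
  have hK : MartApprox.approxConst s c s' C ≠ ∞ := by
    refine ENNReal.add_ne_top.2 ⟨by norm_num, ENNReal.mul_ne_top ENNReal.ofReal_ne_top
      (ENNReal.mul_ne_top (by norm_num) ENNReal.ofReal_ne_top)⟩
  refine ⟨(MartApprox.approxConst s c s' C).toNNReal, ?_⟩
  intro Ω F₀ mΩ P _ H _ _ _ _ θ hθ hF hF₀ X₀ hX₀ hXp _ hfin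
  set A := MartApprox.LpAdaptedShift (ENNReal.ofReal p) H hθ hF hF₀ with hA
  set x := hXp.toLp X₀ with hx
  have hxX : x =ᵐ[P] X₀ := hXp.coeFn_toLp
  have hQx : A.Q x = x := by
    refine Lp.ext ((MartApprox.coeFn_LpCondExp x).trans ((condExp_congr_ae hxX).trans ?_))
    rw [condExp_of_stronglyMeasurable hF hX₀ (hXp.integrable hFact.out)]
    exact hxX.symm
  have htail : ∀ m, MartApprox.mwTail F₀ P θ X₀ p m = MartApprox.wTail (A.projNorm x) s m := by
    intro m
    simp only [MartApprox.mwTail, MartApprox.wTail, hA,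
      MartApprox.projNorm_eq hθ hF hF₀ hxX, hs]
  rw [htail] at hfin
  have hconv : MartApprox.ConvexType (Lp H (ENNReal.ofReal p) P) s c :=
    MartApprox.convexType_Lp hp
  have hsmooth : MartApprox.SmoothType (Lp H (ENNReal.ofReal p) P) s' C :=
    MartApprox.smoothType_Lp hp
  have hsum := A.summable_norm_regTail (x := x) (by linarith) hc0 hconv hfin
  obtain ⟨G, hG⟩ := MartApprox.exists_LpHasSum_norm hsum
  refine ⟨fun n => A.regTail x n, G, A.generator x, fun n => ?_, hG, ?_, fun n hn => ?_⟩
  · refine MartApprox.LpHasSum.of_tendsto (fun j => ?_)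
      (A.tendsto_regTail hs2 hc0 hconv hfin n)
    filter_upwards [Lp.coeFn_smul ((((n + j : ℕ) : ℝ) + 1)⁻¹)
      (A.innov ((A.U ^ ((n + j : ℕ) : ℤ)) x)), MartApprox.coeFn_innov_ae_eq hθ hF hF₀
      (MartApprox.coeFn_zpow_ae_eq hθ hF hF₀ hxX (n + j))] with ω h1 h2
    rw [h1, Pi.smul_apply, h2]
  · exact MartApprox.LpHasSum.of_tendsto (fun _ => EventuallyEq.rfl)
      hsum.of_norm.hasSum.tendsto_sum_nat
  · have hq : 1 ≤ s / s' := by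
      rw [le_div_iff₀ hs'0, one_mul]
      exact (min_le_left _ _).trans hs2
    -- The horizon is $N = [n^q]$ with $q = s/s' \ge 1$, so $N \ge n$, while $N^{1/s} \le n^{1/s'}$
    -- by `natCast_floor_rpow_le`.
    have hnN : n ≤ ⌊(n : ℝ) ^ (s / s')⌋₊ := by
      refine Nat.le_floor ?_
      calc (n : ℝ) = (n : ℝ) ^ (1 : ℝ) := (Real.rpow_one _).symm
        _ ≤ _ := Real.rpow_le_rpow_of_exponent_le (by exact_mod_cast hn) hq
    have h := A.enorm_S_sub_S_generator_le hQx hs2 hc0 hconv hs'0 hC0 hsmooth hfin hn hnN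
      (MartApprox.natCast_floor_rpow_le hs'0 (by linarith) n)
    rw [ENNReal.coe_toNNReal hK, htail]
    refine le_trans (le_of_eq ?_) h
    rw [Lp.enorm_def]
    refine eLpNorm_congr_ae ?_
    filter_upwards [Lp.coeFn_sub (A.S x n) (A.S (A.generator x) n),
      MartApprox.coeFn_S_ae_eq hθ hF hF₀ hxX n,
      MartApprox.coeFn_S_ae_eq hθ hF hF₀ (Y := A.generator x) EventuallyEq.rfl n] with ω h1 h2 h3
    rw [h1, Pi.sub_apply, h2, h3]
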